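/- For $n\ge 1$ let $z(x)$, $x\in\{0,1\}^n$, be i.i.d. exponential random variables with mean $1$, and let $\pi(x)=z(x)/\sum_{y}z(y)$. Write $x\sim y$ if $x,y\in\{0,1\}^n$ differ in exactly one bit, and consider the random walk on $\{0,1\}^n$ with transition matrix $$P(x,y)=\begin{cases}\dfrac1n\cdot\dfrac{\pi(y)}{\pi(x)+\pi(y)}, & x\sim y,\\[2mm] \dfrac1n\displaystyle\sum_{x'\sim x}\dfrac{\pi(x)}{\pi(x)+\pi(x')}, & x=y,\\[2mm] 0, & \text{otherwise.}\end{cases}$$ For $x\neq y$ let $\mathcal P_{xy}$ be the set of simple directed paths from $x$ to $y$ in the hypercube graph. A multicommodity flow is a function $f:\bigcup_{x\ne y}\mathcal P_{xy}\to[0,\infty)$ with $\sum_{p\in\mathcal P_{xy}}f(p)=1$ for all $x\neq y$. Its resistance is $$R(f)=\max_{e=(e^+,e^-)}\frac{1}{Q(e)}\sum_{x\ne y}\ \sum_{p\in\mathcal P_{xy},\,p\ni e}\pi(x)\pi(y)f(p)\,|p|,\qquad Q(e)=\pi(e^+)P(e^+,e^-),$$ where the maximum is over directed edges of the hypercube and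 $|p|$ is the number of edges of $p$. Let $\lambda_1$ be the second largest eigenvalue of $P$ (counted with multiplicity) and $\tau=1/(1-\lambda_1)$ the relaxation time. There are absolute constants $c,c'>0$ such that for every $n\ge 1$, with probability at least $1-2^{-cn}$ over the choice of $z$, there is a multicommodity flow $f$ with $R(f)\le c'n^2$; moreover, on the same event, $\lambda_1<1$ and $\tau\le c'n^2$. -/

import Mathlib

open MeasureTheory ProbabilityTheory

namespace HypercubeWalk

noncomputable section

/-- The vertex set `{0,1}^n`. -/
abbrev Cube (n : ℕ) : Type := Fin n → Bool

/-- The hypercube graph: two vertices are adjacent when they differ in exactly one bit. -/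
def cubeGraph (n : ℕ) : SimpleGraph (Cube n) where
  Adj x y := hammingDist x y = 1
  symm := ⟨fun x y h => by rw [hammingDist_comm]; exact h⟩
  loopless := ⟨fun x h => by simp at h⟩

instance cubeGraph_decidableRel (n : ℕ) : DecidableRel (cubeGraph n).Adj :=
  fun x y => inferInstanceAs (Decidable (hammingDist x y = 1))

/-- The transition matrix of the walk on the hypercube attached to a weight `π`. -/
def transitionMatrix (n : ℕ) (π : Cube n → ℝ) : Matrix (Cube n) (Cube n) ℝ :=
  Matrix.of fun x y =>
    if x = y then
      (1 / (n : ℝ)) * ∑ x' ∈ (cubeGraph n).neighborFinset x, π x / (π x + π x')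
    else if (cubeGraph n).Adj x y then
      (1 / (n : ℝ)) * (π y / (π x + π y))
    else 0

/-- A multicommodity flow on a graph: for any two distinct vertices `x ≠ y`, a unit flow from `x`
to `y`, split among the simple directed paths from `x` to `y`. (The values on the trivial paths
from `x` to `x` are irrelevant: these paths have no edges.) -/
structure MulticommodityFlow {V : Type*} [Fintype V] [DecidableEq V] (G : SimpleGraph V)
    [DecidableRel G.Adj] where
  val : ∀ {x y : V}, G.Path x y → ℝ
  nonneg : ∀ {x y : V} (p : G.Path x y), 0 ≤ val p
  unit : ∀ x y : V, x ≠ y → ∑ p : G.Path x y, val p = 1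

/-- The resistance of a flow `f` for the chain `P` with stationary distribution `π`:
the maximum over directed edges `e = (u, v)` of
`(1 / Q(e)) * ∑_{x,y} ∑_{p : x → y, p ∋ e} π(x) π(y) f(p) |p|`, where `Q(e) = π(u) P(u,v)`. -/
def resistance {V : Type*} [Fintype V] [DecidableEq V] (G : SimpleGraph V) [DecidableRel G.Adj]
    (π : V → ℝ) (P : Matrix V V ℝ) (f : MulticommodityFlow G) : ℝ :=
  ⨆ e : G.Dart, (1 / (π e.fst * P e.fst e.snd)) *
    ∑ x : V, ∑ y : V, ∑ p : G.Path x y,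
      if e ∈ p.1.darts then π x * π y * f.val p * (p.1.length : ℝ) else 0

/-- The second largest real eigenvalue of a matrix: eigenvalues are listed in decreasing order,
with multiplicity, and the entry with index `1` is taken. -/
def secondEigenvalue {V : Type*} [Fintype V] [DecidableEq V] (P : Matrix V V ℝ) : ℝ :=
  (P.charpoly.roots.sort (· ≥ ·)).getD 1 0

/-- The relaxation time `1 / (1 - λ₁)`, with `λ₁` the second largest eigenvalue. -/
def relaxationTime {V : Type*} [Fintype V] [DecidableEq V] (P : Matrix V V ℝ) : ℝ :=
  1 / (1 - secondEigenvalue P)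

/-- The normalized distribution `π(x) = z(x) / ∑ z`. -/
def normalized {V : Type*} [Fintype V] (z : V → ℝ) : V → ℝ :=
  fun x => z x / ∑ y, z y

end

end HypercubeWalk

namespace HypercubeWalk

/-! ### From a Poincaré inequality to the second eigenvalue of a reversible chain. -/

section Spectral

variable {V : Type*} [Fintype V]

/-! Randomness enters only through the event `WellSpread`: weights are positive, each vertex has at
most `n / 8` neighbours of weight below a fixed threshold ("light"), and every subcube of dimension
`k` has total weight at most `8 (n + 2 ^ k)`. Small-value and Chernoff estimates for exponentials
and a union bound over `2 ^ (2n)` pairs give it probability at least `1 - 2 ^ (-n)`. The rest is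
deterministic.

Routing starts from bit fixing in a cyclic order with uniformly random first direction `s`. If such
a walk from `x` to `y` crosses the edge `u → u + i`, then `x` and `y` lie in complementary subcubes
through `u`, so the subcube bounds control the weight of these pairs; summing over `s` gives `O(n 2
^ n)` (`sum_trace_bitFixing_le`). This walk may meet light vertices, whose edges have small
capacity. It is therefore shadowed: each vertex `u` is replaced by a random heavy neighbour `u + j`,
and each edge `u → u + i` by a walk from `u + j` to `u + i + k` flipping `l, k, i, j, l`. The
direction `l` is chosen at random so that all intermediate vertices are heavy; at least half of the
directions qualify. A triple `(j, k, l)` has probability at most `8 / n ^ 3`, and a given directed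
edge occurs in at most `5 n ^ 3` detours, so on average it serves at most 40 original edges
(`sum_card_detourTrace_le`).

Hence the weight carried by an edge is of the order of the smaller weight of its ends: detours join
heavy vertices, while the first and last steps are handled by `choiceCount_mul_le`. Path lengths
contribute a factor `7n` and the `1 / n` in the transition matrix another `n`, whence `n ^ 2`. The
canonical path argument `poincare_of_flow` turns the flow into a Poincaré inequality, and
`secondEigenvalue_le_of_poincare` into the bound on the relaxation time. -/

lemma sum_mul_sub_sq_eq (a : V → V → ℝ) (b g : V → ℝ)
    (hsymm : ∀ x y, a x y = a y x) (hrow : ∀ x, ∑ y, a x y = b x) :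
    ∑ x, ∑ y, a x y * (g x - g y) ^ 2
      = 2 * ∑ x, b x * g x ^ 2 - 2 * ∑ x, ∑ y, a x y * (g x * g y) := by
  have h1 : ∑ x, ∑ y, a x y * g x ^ 2 = ∑ x, b x * g x ^ 2 :=
    Finset.sum_congr rfl fun x _ => by rw [← Finset.sum_mul, hrow]
  have h2 : ∑ x, ∑ y, a x y * g y ^ 2 = ∑ x, b x * g x ^ 2 := by
    rw [Finset.sum_comm, ← h1]
    exact Finset.sum_congr rfl fun x _ => Finset.sum_congr rfl fun y _ => by rw [hsymm]
  have h3 : ∀ x y, a x y * (g x - g y) ^ 2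
      = a x y * g x ^ 2 + a x y * g y ^ 2 - 2 * (a x y * (g x * g y)) := fun x y => by ring
  simp_rw [h3, Finset.sum_sub_distrib, Finset.sum_add_distrib, h1, h2, ← Finset.mul_sum]
  ring

lemma exists_unit_combination (a b : ℝ) :
    ∃ α β : ℝ, α ^ 2 + β ^ 2 = 1 ∧ α * a + β * b = 0 := by
  by_cases h : a ^ 2 + b ^ 2 = 0
  · refine ⟨1, 0, by norm_num, ?_⟩
    have : a = 0 := by nlinarith [sq_nonneg a, sq_nonneg b]
    simp [this]
  · have hpos : 0 < a ^ 2 + b ^ 2 := lt_of_le_of_ne (by positivity) (Ne.symm h)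
    refine ⟨b / √(a ^ 2 + b ^ 2), -a / √(a ^ 2 + b ^ 2), ?_, by ring⟩
    rw [div_pow, div_pow, Real.sq_sqrt hpos.le]
    field_simp
    ring

variable [DecidableEq V]

/-- For a reversible chain, a Poincaré inequality with constant `R` bounds the second
eigenvalue away from `1`. -/
theorem secondEigenvalue_le_of_poincare (P : Matrix V V ℝ) (π : V → ℝ) (R : ℝ) (hR : 0 < R)
    (hcard : 1 < Fintype.card V) (hπ : ∀ x, 0 < π x) (hsum : ∑ x, π x = 1)
    (hrev : ∀ x y, π x * P x y = π y * P y x) (hrow : ∀ x, ∑ y, P x y = 1)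
    (hpoinc : ∀ g : V → ℝ, ∑ x, ∑ y, π x * π y * (g x - g y) ^ 2
      ≤ R * ∑ x, ∑ y, π x * P x y * (g x - g y) ^ 2) :
    secondEigenvalue P ≤ 1 - 1 / R := by
  set s : V → ℝ := fun x => √(π x) with hs
  have hs0 : ∀ x, s x ≠ 0 := fun x => (Real.sqrt_pos.2 (hπ x)).ne'
  have hss : ∀ x, s x * s x = π x := fun x => Real.mul_self_sqrt (hπ x).le
  -- Conjugation by `√π` makes a reversible matrix symmetric without changing its characteristic
  -- polynomial.
  set A : Matrix V V ℝ := Matrix.diagonal s * P * Matrix.diagonal (fun x => (s x)⁻¹) with hA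
  have hAe : ∀ x y, A x y = s x * P x y * (s y)⁻¹ := fun x y => by
    simp [hA, Matrix.mul_diagonal, Matrix.diagonal_mul]
  have hchar : A.charpoly = P.charpoly := by
    rw [hA, Matrix.charpoly_mul_comm, ← mul_assoc, Matrix.diagonal_mul_diagonal]
    have : (fun i => (s i)⁻¹ * s i) = fun _ => (1 : ℝ) := by
      funext i; exact inv_mul_cancel₀ (hs0 i)
    rw [this, Matrix.diagonal_one, one_mul]
  have hherm : A.IsHermitian := by
    ext x y
    simp only [Matrix.conjTranspose_apply, star_trivial, hAe]
    have := hrev x y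
    rw [← hss, ← hss] at this
    field_simp [hs0 x, hs0 y]
    nlinarith [this]
  let i0 : Fin (Fintype.card V) := ⟨0, by omega⟩
  let i1 : Fin (Fintype.card V) := ⟨1, hcard⟩
  let e := Fintype.equivOfCardEq (Fintype.card_fin (Fintype.card V))
  -- All `|V| ≥ 2` roots are real, so the default value `0` of `getD` is never taken.
  have hsec : secondEigenvalue P = hherm.eigenvalues₀ i1 := by
    unfold secondEigenvalue
    have h := hherm.sort_roots_charpoly_eq_eigenvalues₀
    simp only [RCLike.re_to_real, Multiset.map_id'] at h
    rw [← hchar]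
    rw [h, List.getD_eq_getElem _ _ (by simpa using hcard), List.getElem_ofFn]
  set l0 := hherm.eigenvalues₀ i0 with hl0
  set l1 := hherm.eigenvalues₀ i1 with hl1
  have hle : l1 ≤ l0 := hherm.eigenvalues₀_antitone (by simp [i0, Fin.le_def])
  have he : ∀ i, hherm.eigenvalues (e i) = hherm.eigenvalues₀ i := fun i => by
    simp [Matrix.IsHermitian.eigenvalues, e]
  set v0 : V → ℝ := fun x => hherm.eigenvectorBasis (e i0) x with hv0
  set v1 : V → ℝ := fun x => hherm.eigenvectorBasis (e i1) x with hv1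
  have hne : e i0 ≠ e i1 := e.injective.ne (by simp [i0, i1])
  have horth : ∀ i j, ∑ x, hherm.eigenvectorBasis i x * hherm.eigenvectorBasis j x
      = if i = j then 1 else 0 := fun i j => by
    rw [← orthonormal_iff_ite.1 hherm.eigenvectorBasis.orthonormal i j, PiLp.inner_apply]
    exact Finset.sum_congr rfl fun x _ => by simp [mul_comm]
  have h00 : ∑ x, v0 x * v0 x = 1 := by simpa using horth (e i0) (e i0)
  have h11 : ∑ x, v1 x * v1 x = 1 := by simpa using horth (e i1) (e i1)
  have h01 : ∑ x, v0 x * v1 x = 0 := by simpa [hne] using horth (e i0) (e i1)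
  have hA0 : ∀ x, ∑ y, A x y * v0 y = l0 * v0 x := fun x => by
    have := congrFun (hherm.mulVec_eigenvectorBasis (e i0)) x
    rw [he] at this
    simpa [Matrix.mulVec, dotProduct] using this
  have hA1 : ∀ x, ∑ y, A x y * v1 y = l1 * v1 x := fun x => by
    have := congrFun (hherm.mulVec_eigenvectorBasis (e i1)) x
    rw [he] at this
    simpa [Matrix.mulVec, dotProduct] using this
  -- Courant–Fischer: the span of the top two eigenvectors contains a unit vector `φ` orthogonal to
  -- `√π`, and its Rayleigh quotient is at least `l1`.
  obtain ⟨α, β, hαβ, hort⟩ := exists_unit_combination (∑ x, v0 x * s x) (∑ x, v1 x * s x)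
  set φ : V → ℝ := fun x => α * v0 x + β * v1 x with hφ
  have hφs : ∑ x, φ x * s x = 0 := by
    rw [← hort, Finset.mul_sum, Finset.mul_sum, ← Finset.sum_add_distrib]
    exact Finset.sum_congr rfl fun x _ => by simp only [hφ]; ring
  have hφφ : ∑ x, φ x * φ x = 1 := by
    have : ∀ x, φ x * φ x = α ^ 2 * (v0 x * v0 x) + β ^ 2 * (v1 x * v1 x)
        + 2 * α * β * (v0 x * v1 x) := fun x => by simp only [hφ]; ring
    simp_rw [this, Finset.sum_add_distrib, ← Finset.mul_sum, h00, h11, h01]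
    linarith
  have hφA : l1 ≤ ∑ x, ∑ y, φ x * (A x y * φ y) := by
    have h1 : ∀ x, ∑ y, φ x * (A x y * φ y) = φ x * (α * (l0 * v0 x) + β * (l1 * v1 x)) := by
      intro x
      rw [← Finset.mul_sum]
      congr 1
      rw [← hA0, ← hA1, Finset.mul_sum Finset.univ (fun y => A x y * v0 y),
        Finset.mul_sum Finset.univ (fun y => A x y * v1 y), ← Finset.sum_add_distrib]
      exact Finset.sum_congr rfl fun y _ => by simp only [hφ]; ring
    have h2 : ∀ x, φ x * (α * (l0 * v0 x) + β * (l1 * v1 x)) = α ^ 2 * l0 * (v0 x * v0 x)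
        + β ^ 2 * l1 * (v1 x * v1 x) + α * β * (l0 + l1) * (v0 x * v1 x) := fun x => by
      simp only [hφ]; ring
    simp_rw [h1, h2, Finset.sum_add_distrib, ← Finset.mul_sum, h00, h11, h01]
    have h3 : l1 = (α ^ 2 + β ^ 2) * l1 := by rw [hαβ, one_mul]
    nlinarith [mul_le_mul_of_nonneg_left hle (sq_nonneg α)]
  -- In terms of `g`, the conditions on `φ` say mean zero and variance one under `π`.
  set g : V → ℝ := fun x => φ x / s x with hg
  have hsg : ∀ x, s x * g x = φ x := fun x => by simp only [hg]; field_simp [hs0 x]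
  have hp := hpoinc g
  rw [sum_mul_sub_sq_eq (fun x y => π x * π y) π g (fun x y => mul_comm _ _)
      (fun x => by rw [← Finset.mul_sum, hsum, mul_one]),
    sum_mul_sub_sq_eq (fun x y => π x * P x y) π g hrev
      (fun x => by rw [← Finset.mul_sum, hrow, mul_one])] at hp
  have hn : ∑ x, π x * g x ^ 2 = 1 := by
    rw [← hφφ]
    exact Finset.sum_congr rfl fun x _ => by rw [← hsg, ← hss]; ring
  have hz : ∑ x, π x * g x = 0 := by
    rw [← hφs]
    exact Finset.sum_congr rfl fun x _ => by rw [← hsg, ← hss]; ring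
  have hz2 : ∑ x, ∑ y, π x * π y * (g x * g y) = 0 := by
    have : ∀ x y, π x * π y * (g x * g y) = (π x * g x) * (π y * g y) := fun x y => by ring
    simp_rw [this, ← Finset.mul_sum, hz, mul_zero, Finset.sum_const_zero]
  have hq : ∑ x, ∑ y, π x * P x y * (g x * g y) = ∑ x, ∑ y, φ x * (A x y * φ y) :=
    Finset.sum_congr rfl fun x _ => Finset.sum_congr rfl fun y _ => by
      rw [← hsg, ← hsg, hAe, ← hss]
      field_simp [hs0 y]
  rw [hn, hz2, hq] at hp
  rw [hsec]
  have : 1 ≤ R * (1 - l1) := by nlinarith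
  have : 1 / R ≤ 1 - l1 := by
    rw [div_le_iff₀ hR]; linarith
  linarith

/-! ### The canonical path method for flows. -/

section Poincare

variable {G : SimpleGraph V} [DecidableRel G.Adj]

omit [Fintype V] [DecidableEq V] [DecidableRel G.Adj] in
lemma sum_map_darts_sub (g : V → ℝ) {x y : V} (p : G.Walk x y) :
    (p.darts.map fun e => g e.snd - g e.fst).sum = g y - g x := by
  induction p with
  | nil => simp
  | cons h p ih => simp [ih]

-- Telescoping along the path and Cauchy–Schwarz; simplicity makes the darts distinct, so their list
-- may be read as a finset.
omit [Fintype V] [DecidableRel G.Adj] in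
lemma sq_sub_le_length_mul_sum (g : V → ℝ) {x y : V} (p : G.Path x y) :
    (g x - g y) ^ 2 ≤ (p.1.length : ℝ) *
      ∑ e ∈ p.1.darts.toFinset, (g e.fst - g e.snd) ^ 2 := by
  have hnd : p.1.darts.Nodup := SimpleGraph.Walk.darts_nodup_of_support_nodup p.2.support_nodup
  have h1 : g y - g x = ∑ e ∈ p.1.darts.toFinset, (g e.snd - g e.fst) := by
    rw [List.sum_toFinset _ hnd, sum_map_darts_sub]
  have h2 := sq_sum_le_card_mul_sum_sq (s := p.1.darts.toFinset)
    (f := fun e => g e.snd - g e.fst)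
  rw [← h1, List.toFinset_card_of_nodup hnd, SimpleGraph.Walk.length_darts] at h2
  calc (g x - g y) ^ 2 = (g y - g x) ^ 2 := by ring
    _ ≤ _ := h2
    _ = _ := by
      congr 1
      exact Finset.sum_congr rfl fun e _ => by ring

/-- The total flow through a directed edge, weighted by path lengths. -/
noncomputable def edgeLoad (G : SimpleGraph V) [DecidableRel G.Adj] (π : V → ℝ)
    (f : MulticommodityFlow G) (e : G.Dart) : ℝ :=
  ∑ x : V, ∑ y : V, ∑ p : G.Path x y,
    if e ∈ p.1.darts then π x * π y * f.val p * (p.1.length : ℝ) else 0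

lemma edgeLoad_le_resistance_mul (π : V → ℝ) (P : Matrix V V ℝ) (f : MulticommodityFlow G)
    (hQ : ∀ e : G.Dart, 0 < π e.fst * P e.fst e.snd) (e : G.Dart) :
    edgeLoad G π f e ≤ resistance G π P f * (π e.fst * P e.fst e.snd) := by
  have h : (1 / (π e.fst * P e.fst e.snd)) * edgeLoad G π f e ≤ resistance G π P f :=
    le_ciSup (f := fun e : G.Dart => (1 / (π e.fst * P e.fst e.snd)) * edgeLoad G π f e)
      (Set.finite_range _).bddAbove e
  rw [one_div, inv_mul_le_iff₀ (hQ e)] at h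
  linarith

/-- The canonical path bound: the resistance of a flow is an admissible Poincaré constant. -/
theorem poincare_of_flow (π : V → ℝ) (P : Matrix V V ℝ) (f : MulticommodityFlow G) (R : ℝ)
    (hπ : ∀ x, 0 ≤ π x) (hP : ∀ x y, 0 ≤ P x y)
    (hQ : ∀ e : G.Dart, 0 < π e.fst * P e.fst e.snd) (hR0 : 0 ≤ R)
    (hR : resistance G π P f ≤ R) (g : V → ℝ) :
    ∑ x, ∑ y, π x * π y * (g x - g y) ^ 2
      ≤ R * ∑ x, ∑ y, π x * P x y * (g x - g y) ^ 2 := by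
  have h1 : ∀ x y, π x * π y * (g x - g y) ^ 2 ≤ ∑ e : G.Dart, (g e.fst - g e.snd) ^ 2 *
      ∑ p : G.Path x y,
        if e ∈ p.1.darts then π x * π y * f.val p * (p.1.length : ℝ) else 0 := by
    intro x y
    have hrhs : ∑ e : G.Dart, (g e.fst - g e.snd) ^ 2 * ∑ p : G.Path x y,
        (if e ∈ p.1.darts then π x * π y * f.val p * (p.1.length : ℝ) else 0)
        = ∑ p : G.Path x y, π x * π y * f.val p * ((p.1.length : ℝ) *
          ∑ e ∈ p.1.darts.toFinset, (g e.fst - g e.snd) ^ 2) := by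
      simp_rw [Finset.mul_sum]
      rw [Finset.sum_comm]
      refine Finset.sum_congr rfl fun p _ => ?_
      rw [← Finset.sum_subset (Finset.subset_univ p.1.darts.toFinset)
        (fun e _ he => by rw [if_neg (by simpa using he), mul_zero])]
      exact Finset.sum_congr rfl fun e he => by rw [if_pos (by simpa using he)]; ring
    rw [hrhs]
    rcases eq_or_ne x y with rfl | hxy
    · rw [sub_self, zero_pow two_ne_zero, mul_zero]
      exact Finset.sum_nonneg fun p _ => mul_nonneg
        (mul_nonneg (mul_nonneg (hπ _) (hπ _)) (f.nonneg p))
        (mul_nonneg (Nat.cast_nonneg _) (Finset.sum_nonneg fun _ _ => sq_nonneg _))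
    · calc π x * π y * (g x - g y) ^ 2
          = ∑ p : G.Path x y, π x * π y * f.val p * (g x - g y) ^ 2 := by
            rw [← Finset.sum_mul, ← Finset.mul_sum, f.unit x y hxy, mul_one]
        _ ≤ _ := Finset.sum_le_sum fun p _ => mul_le_mul_of_nonneg_left
            (sq_sub_le_length_mul_sum g p)
            (mul_nonneg (mul_nonneg (hπ _) (hπ _)) (f.nonneg p))
  calc ∑ x, ∑ y, π x * π y * (g x - g y) ^ 2
      ≤ ∑ x, ∑ y, ∑ e : G.Dart, (g e.fst - g e.snd) ^ 2 * ∑ p : G.Path x y,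
        (if e ∈ p.1.darts then π x * π y * f.val p * (p.1.length : ℝ) else 0) :=
        Finset.sum_le_sum fun x _ => Finset.sum_le_sum fun y _ => h1 x y
    _ = ∑ e : G.Dart, (g e.fst - g e.snd) ^ 2 * edgeLoad G π f e := by
        simp_rw [edgeLoad, Finset.mul_sum (s := (Finset.univ : Finset V))]
        rw [Finset.sum_comm]
        conv_rhs => rw [Finset.sum_comm, Finset.sum_congr rfl fun x _ => Finset.sum_comm]
        rw [Finset.sum_comm]
    _ ≤ ∑ e : G.Dart, R * (π e.fst * P e.fst e.snd * (g e.fst - g e.snd) ^ 2) := by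
        refine Finset.sum_le_sum fun e _ => ?_
        have := (edgeLoad_le_resistance_mul π P f hQ e).trans
          (mul_le_mul_of_nonneg_right hR (hQ e).le)
        nlinarith [mul_le_mul_of_nonneg_left this (sq_nonneg (g e.fst - g e.snd))]
    _ ≤ _ := by
        rw [← Finset.mul_sum]
        refine mul_le_mul_of_nonneg_left ?_ hR0
        rw [← Fintype.sum_prod_type' (fun x y => π x * P x y * (g x - g y) ^ 2)]
        rw [← Finset.sum_image (s := Finset.univ)
          (f := fun q : V × V => π q.1 * P q.1 q.2 * (g q.1 - g q.2) ^ 2)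
          (g := fun e : G.Dart => e.toProd)
          (fun a _ b _ h => SimpleGraph.Dart.ext a b h)]
        exact Finset.sum_le_sum_of_subset_of_nonneg (Finset.subset_univ _) fun q _ _ =>
          mul_nonneg (mul_nonneg (hπ _) (hP _ _)) (sq_nonneg _)

end Poincare

end Spectral

/-! ### Tail estimates for independent exponential variables. -/

section Exponential

lemma expMeasure_Iio_le (a : ℝ) (ha : 0 ≤ a) : expMeasure 1 (Set.Iio a) ≤ ENNReal.ofReal a := by
  have : IsProbabilityMeasure (expMeasure 1) := isProbabilityMeasure_expMeasure one_pos
  calc expMeasure 1 (Set.Iio a) ≤ expMeasure 1 (Set.Iic a) :=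
        measure_mono Set.Iio_subset_Iic_self
    _ = ENNReal.ofReal (cdf (expMeasure 1) a) := by rw [ofReal_cdf]
    _ ≤ ENNReal.ofReal a := by
        rw [cdf_expMeasure_eq one_pos, if_pos ha]
        refine ENNReal.ofReal_le_ofReal ?_
        linarith [Real.add_one_le_exp (-(1 * a))]

lemma expMeasure_Iic_zero : expMeasure 1 (Set.Iic 0) = 0 := by
  have : IsProbabilityMeasure (expMeasure 1) := isProbabilityMeasure_expMeasure one_pos
  rw [← ofReal_cdf, cdf_expMeasure_eq one_pos]
  simp

/-- Tilting the rate `1` density by `exp (x / 2)` gives twice the density of rate `1 / 2`. -/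
lemma lintegral_exp_half_expMeasure :
    ∫⁻ x, ENNReal.ofReal (Real.exp (1 / 2 * x)) ∂(expMeasure 1) = 2 := by
  have h : ∀ x, exponentialPDF 1 x * ENNReal.ofReal (Real.exp (1 / 2 * x))
      = 2 * exponentialPDF (1 / 2) x := by
    intro x
    rcases le_or_gt 0 x with hx | hx
    · rw [exponentialPDF_of_nonneg hx, exponentialPDF_of_nonneg hx,
        ← ENNReal.ofReal_mul (by positivity),
        show (2 : ENNReal) = ENNReal.ofReal 2 by simp, ← ENNReal.ofReal_mul (by positivity),
        mul_assoc, ← Real.exp_add]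
      congr 1
      ring_nf
    · rw [exponentialPDF_of_neg hx, exponentialPDF_of_neg hx, zero_mul, mul_zero]
  have hd : expMeasure 1 = volume.withDensity (exponentialPDF 1) := rfl
  have hm : ∀ r, Measurable (exponentialPDF r) := fun r =>
    (measurable_exponentialPDFReal r).ennreal_ofReal
  rw [hd, lintegral_withDensity_eq_lintegral_mul _ (hm 1) (by fun_prop)]
  simp only [Pi.mul_apply, h]
  rw [lintegral_const_mul _ (hm _), lintegral_exponentialPDF_eq_one (by norm_num), mul_one]

lemma integral_exp_half_expMeasure : ∫ x, Real.exp (1 / 2 * x) ∂(expMeasure 1) = 2 := by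
  rw [integral_eq_lintegral_of_nonneg_ae (Filter.Eventually.of_forall fun x => (Real.exp_pos _).le)
    (by fun_prop), lintegral_exp_half_expMeasure]
  simp

variable {Ω ι : Type*} [MeasurableSpace Ω] {μ : Measure Ω} [IsProbabilityMeasure μ]
  {z : ι → Ω → ℝ}

omit [IsProbabilityMeasure μ] in
lemma measure_nonpos_eq_zero {Z : Ω → ℝ} (h : HasLaw Z (expMeasure 1) μ) :
    μ {ω | Z ω ≤ 0} = 0 := by
  rw [h.measure_eq (p := fun x => x ≤ 0) measurableSet_Iic]
  exact expMeasure_Iic_zero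

omit [IsProbabilityMeasure μ] in
lemma measure_forall_lt_le (hz : ∀ i, HasLaw (z i) (expMeasure 1) μ) (hind : iIndepFun z μ)
    (T : Finset ι) (a : ℝ) (ha : 0 ≤ a) :
    μ {ω | ∀ i ∈ T, z i ω < a} ≤ ENNReal.ofReal (a ^ T.card) := by
  have h := hind.measure_inter_preimage_eq_mul T (sets := fun _ => Set.Iio a)
    (fun _ _ => measurableSet_Iio)
  have he : {ω | ∀ i ∈ T, z i ω < a} = ⋂ i ∈ T, z i ⁻¹' Set.Iio a := by ext; simp
  rw [he, h, ENNReal.ofReal_pow ha, ← Finset.prod_const]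
  refine Finset.prod_le_prod' fun i _ => ?_
  exact ((hz i).measure_eq (p := fun x => x < a) measurableSet_Iio).trans_le
    (expMeasure_Iio_le a ha)

/-- Chernoff's bound at parameter `1 / 2`, where each variable has moment generating function `2`.
-/
lemma measure_le_sum_le (hz : ∀ i, HasLaw (z i) (expMeasure 1) μ) (hind : iIndepFun z μ)
    (T : Finset ι) (b : ℝ) :
    μ {ω | b ≤ ∑ i ∈ T, z i ω} ≤ ENNReal.ofReal (Real.exp (-(b / 2)) * 2 ^ T.card) := by
  have hm : ∀ i, AEMeasurable (z i) μ := fun i => (hz i).aemeasurable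
  have hmgf : ∀ i, mgf (z i) μ (1 / 2) = 2 := fun i => by
    have h := integral_exp_half_expMeasure
    rwa [← (hz i).map_eq, integral_map (hm i) (by fun_prop)] at h
  have hsum : mgf (∑ i ∈ T, z i) μ (1 / 2) = 2 ^ T.card := by
    rw [hind.mgf_sum₀ hm, Finset.prod_congr rfl fun i _ => hmgf i, Finset.prod_const]
  have h := measure_ge_le_exp_mul_mgf (μ := μ) (X := ∑ i ∈ T, z i) (t := 1 / 2) b (by norm_num)
    -- Integrability comes for free: a non-integrable function would have integral `0`, but this one
    -- is a power of `2`.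
    (not_imp_comm.1 integral_undef
      (by rw [← mgf, hsum]; positivity))
  rw [hsum] at h
  simp only [Finset.sum_apply] at h
  rw [← ENNReal.ofReal_toReal (measure_ne_top μ {ω | b ≤ ∑ i ∈ T, z i ω})]
  refine ENNReal.ofReal_le_ofReal (h.trans_eq ?_)
  congr 2
  ring

end Exponential

/-! ### The event on which the flow exists, and its probability. -/

section GoodEvent

/-- Flip the `i`-th bit of `v`. -/
def flipBit {n : ℕ} (v : Cube n) (i : Fin n) : Cube n := Function.update v i (!v i)

lemma flipBit_apply {n : ℕ} (v : Cube n) (i c : Fin n) :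
    flipBit v i c = if c = i then !v c else v c := by
  unfold flipBit
  rcases eq_or_ne c i with rfl | h
  · simp
  · simp [h]

lemma flipBit_injective {n : ℕ} (v : Cube n) : Function.Injective (flipBit v) := by
  intro i j h
  by_contra hij
  have := congrFun h i
  simp [flipBit_apply, hij] at this

/-- The subcube through `u` with free coordinates `S`. -/
def subcube {n : ℕ} (u : Cube n) (S : Finset (Fin n)) : Finset (Cube n) :=
  Finset.univ.filter fun x => ∀ c ∉ S, x c = u c

lemma card_subcube_le {n : ℕ} (u : Cube n) (S : Finset (Fin n)) :
    (subcube u S).card ≤ 2 ^ S.card := by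
  have h : (subcube u S).card ≤ (Finset.univ : Finset (S → Bool)).card := by
    refine Finset.card_le_card_of_injOn (fun x c => x c) (fun _ _ => Finset.mem_univ _) ?_
    intro x hx y hy hxy
    simp only [subcube, Finset.coe_filter, Finset.mem_univ, true_and, Set.mem_ofPred_eq] at hx hy
    funext c
    by_cases hc : c ∈ S
    · exact congrFun hxy ⟨c, hc⟩
    · rw [hx c hc, hy c hc]
  simpa using h

/-- Vertices whose weight is below this threshold are avoided by the flow. -/
noncomputable def threshold : ℝ := 1 / 2 ^ 32

/-- The deterministic properties of the weights on which the construction of the flow relies. -/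
structure WellSpread (n : ℕ) (z : Cube n → ℝ) : Prop where
  pos : ∀ x, 0 < z x
  few_light : ∀ v, 8 * (Finset.univ.filter fun l => z (flipBit v l) < threshold).card ≤ n
  sum_subcube_le : ∀ u S, ∑ x ∈ subcube u S, z x ≤ 8 * (n + 2 ^ S.card)

variable {Ω : Type*} [MeasurableSpace Ω] {μ : Measure Ω} [IsProbabilityMeasure μ]
  {n : ℕ} {z : Cube n → Ω → ℝ}

omit [IsProbabilityMeasure μ] in
lemma measure_light_le (hz : ∀ i, HasLaw (z i) (expMeasure 1) μ) (hind : iIndepFun z μ)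
    (v : Cube n) (T : Finset (Fin n)) (hT : n < 8 * T.card) :
    μ {ω | ∀ l ∈ T, z (flipBit v l) ω < threshold} ≤ ENNReal.ofReal ((1 / 2) ^ (4 * n)) := by
  have h := measure_forall_lt_le hz hind (T.map ⟨flipBit v, flipBit_injective v⟩) threshold
    (by unfold threshold; positivity)
  rw [Finset.card_map] at h
  refine le_trans (le_of_eq (by simp)) (h.trans (ENNReal.ofReal_le_ofReal ?_))
  -- The exponent 32 in `threshold` is chosen so that `32 |T| ≥ 4n` as soon as `8 |T| > n`.
  rw [threshold, ← one_div_pow, ← pow_mul]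
  exact pow_le_pow_of_le_one (by norm_num) (by norm_num) (by omega)

lemma measure_sum_subcube_le (hz : ∀ i, HasLaw (z i) (expMeasure 1) μ) (hind : iIndepFun z μ)
    (u : Cube n) (S : Finset (Fin n)) :
    μ {ω | 8 * ((n : ℝ) + 2 ^ S.card) ≤ ∑ x ∈ subcube u S, z x ω}
      ≤ ENNReal.ofReal ((1 / 2) ^ (4 * n)) := by
  refine (measure_le_sum_le hz hind (subcube u S) _).trans (ENNReal.ofReal_le_ofReal ?_)
  have he : Real.exp (-1) ≤ 1 / 2 := by
    rw [Real.exp_neg, one_div]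
    exact inv_anti₀ (by norm_num) (by linarith [Real.add_one_le_exp (1 : ℝ)])
  have h1 : Real.exp (-(8 * ((n : ℝ) + 2 ^ S.card) / 2))
      = Real.exp (-1) ^ (4 * n) * Real.exp (-1) ^ (4 * 2 ^ S.card) := by
    rw [← pow_add, ← Real.exp_nat_mul]
    congr 1
    push_cast
    ring
  have h2 : Real.exp (-1) ^ (4 * n) ≤ (1 / 2) ^ (4 * n) :=
    pow_le_pow_left₀ (Real.exp_pos _).le he _
  -- This factor absorbs the moment generating function, at most `2 ^ (2 ^ |S|)`.
  have h3 : Real.exp (-1) ^ (4 * 2 ^ S.card) ≤ (1 / 2) ^ (2 ^ S.card) :=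
    (pow_le_pow_left₀ (Real.exp_pos _).le he _).trans
      (pow_le_pow_of_le_one (by norm_num) (by norm_num) (by omega))
  have h4 : (2 : ℝ) ^ (subcube u S).card ≤ 2 ^ (2 ^ S.card) :=
    pow_le_pow_right₀ (by norm_num) (card_subcube_le u S)
  calc _ ≤ (1 / 2 : ℝ) ^ (4 * n) * (1 / 2) ^ (2 ^ S.card) * 2 ^ (2 ^ S.card) := by
        rw [h1]
        gcongr
    _ = (1 / 2) ^ (4 * n) := by rw [mul_assoc, ← mul_pow]; norm_num

lemma measure_not_wellSpread_le (hn : 1 ≤ n) (hz : ∀ i, HasLaw (z i) (expMeasure 1) μ)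
    (hind : iIndepFun z μ) :
    μ {ω | ¬ WellSpread n fun x => z x ω} ≤ ENNReal.ofReal ((1 / 2) ^ n) := by
  have hsub : {ω | ¬ WellSpread n fun x => z x ω} ⊆
      (⋃ x, {ω | z x ω ≤ 0}) ∪
      ((⋃ q : Cube n × Finset (Fin n), {ω | n < 8 * q.2.card ∧
          ∀ l ∈ q.2, z (flipBit q.1 l) ω < threshold}) ∪
        ⋃ q : Cube n × Finset (Fin n),
          {ω | 8 * ((n : ℝ) + 2 ^ q.2.card) ≤ ∑ x ∈ subcube q.1 q.2, z x ω}) := by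
    intro ω hω
    by_contra hcon
    simp only [Set.mem_union, Set.mem_iUnion, Set.mem_ofPred_eq, not_or, not_exists, not_le,
      Prod.forall] at hcon
    refine hω ⟨hcon.1, fun v => ?_, fun u S => (hcon.2.2 u S).le⟩
    by_contra hv
    exact hcon.2.1 v _ ⟨not_le.1 hv, fun l hl => by simpa using hl⟩
  have hcard : Fintype.card (Cube n × Finset (Fin n)) = 2 ^ (2 * n) := by
    simp [← pow_add, two_mul]
  -- Each of the `2 ^ (2n)` pairs fails with probability at most `2 ^ (-4n)`.
  have hunion : ∀ s : Cube n × Finset (Fin n) → Set Ω,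
      (∀ q, μ (s q) ≤ ENNReal.ofReal ((1 / 2) ^ (4 * n))) →
      μ (⋃ q, s q) ≤ ENNReal.ofReal ((1 / 2) ^ (2 * n)) := by
    intro s hs
    calc μ (⋃ q, s q) ≤ ∑ q, μ (s q) := measure_iUnion_fintype_le _ _
      _ ≤ ∑ _q : Cube n × Finset (Fin n), ENNReal.ofReal ((1 / 2) ^ (4 * n)) :=
        Finset.sum_le_sum fun q _ => hs q
      _ = ENNReal.ofReal ((1 / 2) ^ (2 * n)) := by
        rw [Finset.sum_const, Finset.card_univ, hcard, ← ENNReal.ofReal_nsmul]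
        congr 1
        rw [nsmul_eq_mul, show 4 * n = 2 * n + 2 * n by ring, pow_add, ← mul_assoc]
        push_cast
        rw [← mul_pow]
        norm_num
  have h0 : μ (⋃ x, {ω | z x ω ≤ 0}) = 0 :=
    measure_iUnion_null fun x => measure_nonpos_eq_zero (hz x)
  have h1 := hunion (fun q => {ω | n < 8 * q.2.card ∧
      ∀ l ∈ q.2, z (flipBit q.1 l) ω < threshold}) fun q => by
    by_cases hq : n < 8 * q.2.card
    · simpa [hq] using measure_light_le hz hind q.1 q.2 hq
    · simp [hq]
  have h2 := hunion (fun q => {ω | 8 * ((n : ℝ) + 2 ^ q.2.card) ≤ ∑ x ∈ subcube q.1 q.2, z x ω})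
    fun q => measure_sum_subcube_le hz hind q.1 q.2
  refine (measure_mono hsub).trans ((measure_union_le _ _).trans ?_)
  rw [h0, zero_add]
  refine (measure_union_le _ _).trans ((add_le_add h1 h2).trans ?_)
  rw [← ENNReal.ofReal_add (by positivity) (by positivity)]
  refine ENNReal.ofReal_le_ofReal ?_
  have h3 : ((1 : ℝ) / 2) ^ n ≤ 1 / 2 := by
    simpa using pow_le_pow_of_le_one (a := (1 / 2 : ℝ)) (by norm_num) (by norm_num) hn
  have h4 : (0 : ℝ) < (1 / 2) ^ n := by positivity
  rw [two_mul, pow_add]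
  nlinarith

end GoodEvent

/-! ### Bit-fixing walks and their shadows. -/

section Routes

variable {n : ℕ}

lemma flipBit_flipBit (v : Cube n) (i : Fin n) : flipBit (flipBit v i) i = v := by
  funext c
  by_cases h : c = i <;> simp [flipBit_apply, h]

lemma flipBit_right_comm (v : Cube n) (i j : Fin n) :
    flipBit (flipBit v i) j = flipBit (flipBit v j) i := by
  funext c
  simp only [flipBit_apply]
  split_ifs <;> rfl

lemma flipBit_left_injective (i : Fin n) : Function.Injective fun v : Cube n => flipBit v i :=
  fun u v h => by rw [← flipBit_flipBit u i, ← flipBit_flipBit v i]; exact congrArg (flipBit · i) h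

lemma flipBit_ne (v : Cube n) (i : Fin n) : flipBit v i ≠ v := fun h => by
  have := congrFun h i
  simp [flipBit_apply] at this

lemma adj_iff_exists_flipBit (x y : Cube n) :
    (cubeGraph n).Adj x y ↔ ∃ i, y = flipBit x i := by
  change hammingDist x y = 1 ↔ _
  rw [hammingDist, Finset.card_eq_one]
  constructor
  · rintro ⟨i, hi⟩
    refine ⟨i, funext fun c => ?_⟩
    have hc : x c ≠ y c ↔ c = i := by simpa using Finset.ext_iff.1 hi c
    rw [flipBit_apply]
    split_ifs with h
    · have := hc.2 h
      revert this
      cases x c <;> cases y c <;> simp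
    · exact (not_not.1 (mt hc.1 h)).symm
  · rintro ⟨i, rfl⟩
    refine ⟨i, Finset.ext fun c => ?_⟩
    by_cases h : c = i <;> simp [flipBit_apply, h]

/-- The vertex reached from `x` after flipping successively the bits in a list. -/
def endpoint (x : Cube n) (L : List (Fin n)) : Cube n := L.foldl flipBit x

/-- The successive (vertex, direction) pairs of the walk from `x` flipping the bits in a list. -/
def trace : Cube n → List (Fin n) → List (Cube n × Fin n)
  | _, [] => []
  | x, i :: L => (x, i) :: trace (flipBit x i) L

@[simp] lemma endpoint_nil (x : Cube n) : endpoint x [] = x := rfl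

@[simp] lemma endpoint_cons (x : Cube n) (i : Fin n) (L : List (Fin n)) :
    endpoint x (i :: L) = endpoint (flipBit x i) L := rfl

lemma endpoint_append (x : Cube n) (L M : List (Fin n)) :
    endpoint x (L ++ M) = endpoint (endpoint x L) M := List.foldl_append

@[simp] lemma trace_nil (x : Cube n) : trace x [] = [] := rfl

@[simp] lemma trace_cons (x : Cube n) (i : Fin n) (L : List (Fin n)) :
    trace x (i :: L) = (x, i) :: trace (flipBit x i) L := rfl

lemma trace_append (x : Cube n) (L M : List (Fin n)) :
    trace x (L ++ M) = trace x L ++ trace (endpoint x L) M := by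
  induction L generalizing x with
  | nil => rfl
  | cons i L ih => simp [ih]

/-- Loop erasure shortens a walk and creates no new darts, so loads may be counted on walks with
repetitions. -/
lemma exists_path_of_list (x y : Cube n) (L : List (Fin n)) (h : endpoint x L = y) :
    ∃ p : (cubeGraph n).Path x y, p.1.length ≤ L.length ∧
      ∀ e ∈ p.1.darts, ∃ i, (e.fst, i) ∈ trace x L ∧ e.snd = flipBit e.fst i := by
  have hw : ∃ w : (cubeGraph n).Walk x y, w.length = L.length ∧
      ∀ e ∈ w.darts, ∃ i, (e.fst, i) ∈ trace x L ∧ e.snd = flipBit e.fst i := by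
    induction L generalizing x with
    | nil =>
      obtain rfl : x = y := h
      exact ⟨.nil, rfl, by simp⟩
    | cons i L ih =>
      obtain ⟨w, hw, hd⟩ := ih (flipBit x i) h
      refine ⟨.cons ((adj_iff_exists_flipBit _ _).2 ⟨i, rfl⟩) w, by simp [hw], ?_⟩
      intro e he
      rw [SimpleGraph.Walk.darts_cons, List.mem_cons] at he
      rcases he with rfl | he
      · exact ⟨i, by simp, rfl⟩
      · obtain ⟨k, hk, hk'⟩ := hd e he
        exact ⟨k, by simp [hk], hk'⟩
  obtain ⟨w, hw, hd⟩ := hw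
  exact ⟨w.toPath, hw ▸ w.length_bypass_le_length,
    fun e he => hd e (w.darts_toPath_subset_darts he)⟩

/-- The bits of a list in which `x` and `y` differ, in the order of the list. -/
def bitFixing (x y : Cube n) (o : List (Fin n)) : List (Fin n) := o.filter fun c => x c ≠ y c

lemma bitFixing_flipBit (x y : Cube n) (a : Fin n) (o : List (Fin n)) (ha : a ∉ o) :
    bitFixing (flipBit x a) y o = bitFixing x y o := by
  refine List.filter_congr fun c hc => ?_
  have : c ≠ a := fun h => ha (h ▸ hc)
  simp [flipBit_apply, this]

lemma flipBit_apply_self_of_ne {x y : Cube n} {a : Fin n} (h : x a ≠ y a) :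
    flipBit x a a = y a := by
  rw [flipBit_apply, if_pos rfl]
  revert h
  cases x a <;> cases y a <;> simp

lemma endpoint_bitFixing (x y : Cube n) (o : List (Fin n)) (ho : o.Nodup)
    (hc : ∀ c, c ∉ o → x c = y c) : endpoint x (bitFixing x y o) = y := by
  induction o generalizing x with
  | nil => exact funext fun c => hc c (by simp)
  | cons a o ih =>
    rw [List.nodup_cons] at ho
    by_cases h : x a = y a
    · have : bitFixing x y (a :: o) = bitFixing x y o := by simp [bitFixing, h]
      rw [this]
      refine ih x ho.2 fun c hco => ?_
      rcases eq_or_ne c a with rfl | hca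
      · exact h
      · exact hc c (by simp [hca, hco])
    · have : bitFixing x y (a :: o) = a :: bitFixing (flipBit x a) y o := by
        rw [bitFixing_flipBit x y a o ho.1]
        simp [bitFixing, h]
      rw [this, endpoint_cons]
      refine ih _ ho.2 fun c hco => ?_
      rcases eq_or_ne c a with rfl | hca
      · exact flipBit_apply_self_of_ne h
      · rw [flipBit_apply, if_neg hca]
        exact hc c (by simp [hca, hco])

/-- When direction `i` is about to be flipped, exactly the bits before it in the order have been set
to those of `y`. -/
lemma exists_split_of_mem_trace_bitFixing (x y u : Cube n) (i : Fin n) (o : List (Fin n))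
    (ho : o.Nodup) (hu : (u, i) ∈ trace x (bitFixing x y o)) :
    ∃ pre post, o = pre ++ i :: post ∧ (∀ c ∉ pre, u c = x c) ∧ ∀ c ∈ pre, u c = y c := by
  induction o generalizing x with
  | nil => simp [bitFixing] at hu
  | cons a o ih =>
    rw [List.nodup_cons] at ho
    by_cases h : x a = y a
    · have : bitFixing x y (a :: o) = bitFixing x y o := by simp [bitFixing, h]
      rw [this] at hu
      obtain ⟨pre, post, rfl, h1, h2⟩ := ih x ho.2 hu
      refine ⟨a :: pre, post, rfl, fun c hc => h1 c fun h' => hc (by simp [h']), ?_⟩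
      intro c hc
      rcases List.mem_cons.1 hc with rfl | hc
      · rw [← h]
        exact h1 c fun h' => ho.1 (by simp [h'])
      · exact h2 c hc
    · have : bitFixing x y (a :: o) = a :: bitFixing (flipBit x a) y o := by
        rw [bitFixing_flipBit x y a o ho.1]
        simp [bitFixing, h]
      rw [this, trace_cons, List.mem_cons, Prod.mk.injEq] at hu
      rcases hu with ⟨rfl, rfl⟩ | hu
      · exact ⟨[], o, rfl, by simp, by simp⟩
      · obtain ⟨pre, post, rfl, h1, h2⟩ := ih _ ho.2 hu
        refine ⟨a :: pre, post, rfl, fun c hc => ?_, fun c hc => ?_⟩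
        · rw [List.mem_cons, not_or] at hc
          rw [h1 c hc.2, flipBit_apply, if_neg hc.1]
        · rcases List.mem_cons.1 hc with rfl | hc
          · rw [← flipBit_apply_self_of_ne h]
            exact h1 c fun h' => ho.1 (by simp [h'])
          · exact h2 c hc

section Cyclic

variable [NeZero n]

/-- The directions `s, s + 1, s + 2, …` in cyclic order. -/
def cyclicOrder (s : Fin n) : List (Fin n) := (List.finRange n).map (s + ·)

lemma pairwise_cyclicOrder (s : Fin n) : (cyclicOrder s).Pairwise fun c c' => c - s < c' - s := by
  rw [cyclicOrder, List.pairwise_map]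
  simpa using List.pairwise_lt_finRange n

omit [NeZero n] in
lemma nodup_cyclicOrder (s : Fin n) : (cyclicOrder s).Nodup :=
  (List.nodup_finRange n).map (add_right_injective s)

lemma mem_cyclicOrder (s c : Fin n) : c ∈ cyclicOrder s :=
  List.mem_map.2 ⟨c - s, List.mem_finRange _, by simp⟩

/-- The directions preceding `i` in the cyclic order starting at `s`. -/
def precedingBits (s i : Fin n) : Finset (Fin n) := Finset.univ.filter fun c => c - s < i - s

lemma card_precedingBits (s i : Fin n) : (precedingBits s i).card = (i - s).val := by
  rw [← Fin.card_Iio]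
  refine Finset.card_bij (fun c _ => c - s) ?_ ?_ ?_
  · intro c hc
    simpa [precedingBits] using hc
  · intro c _ c' _ h
    simpa using h
  · intro b hb
    exact ⟨b + s, by simpa [precedingBits] using hb, by simp⟩

lemma mem_subcube_of_mem_trace (x y u : Cube n) (s i : Fin n)
    (hu : (u, i) ∈ trace x (bitFixing x y (cyclicOrder s))) :
    x ∈ subcube u (precedingBits s i) ∧ y ∈ subcube u (precedingBits s i)ᶜ := by
  obtain ⟨pre, post, ho, h1, h2⟩ :=
    exists_split_of_mem_trace_bitFixing x y u i _ (nodup_cyclicOrder s) hu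
  have hp := pairwise_cyclicOrder s
  rw [ho, List.pairwise_append, List.pairwise_cons] at hp
  have hmem : ∀ c, c ∈ pre ↔ c ∈ precedingBits s i := by
    intro c
    simp only [precedingBits, Finset.mem_filter, Finset.mem_univ, true_and]
    refine ⟨fun hc => hp.2.2 c hc i (by simp), fun hc => ?_⟩
    have := mem_cyclicOrder s c
    rw [ho, List.mem_append, List.mem_cons] at this
    rcases this with h | rfl | h
    · exact h
    · exact absurd hc (lt_irrefl _)
    · exact absurd hc (hp.2.1.1 c h).asymm
  simp only [subcube, Finset.mem_filter, Finset.mem_univ, true_and]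
  refine ⟨fun c hc => (h1 c (mt (hmem c).1 hc)).symm, fun c hc => (h2 c ?_).symm⟩
  rw [hmem]
  simpa using hc

end Cyclic

/-- The places where a random choice of direction is made: one for every vertex, and one for
every edge together with the choices made at its endpoints. -/
abbrev ChoiceIndex (n : ℕ) : Type := Cube n ⊕ (Cube n × Fin n × Fin n × Fin n)

/-- The five pairs (vertex, direction) met when the edge from `u` in direction `i` is replaced by
the walk from `u + j` to `u + i + k` that starts and ends with `l`. -/
def detourTrace (u : Cube n) (i j k l : Fin n) : List (Cube n × Fin n) :=
  trace (flipBit u j) [l, k, i, j, l]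

/-- The walk replacing the edge from `u` in direction `i`, for the choices `J`. -/
def detourStep (J : ChoiceIndex n → Fin n) (u : Cube n) (i : Fin n) : List (Fin n) :=
  [J (.inr (u, i, J (.inl u), J (.inl (flipBit u i)))), J (.inl (flipBit u i)), i, J (.inl u),
    J (.inr (u, i, J (.inl u), J (.inl (flipBit u i))))]

/-- The concatenation of the replacements of all edges of a walk. -/
def detour (J : ChoiceIndex n → Fin n) : Cube n → List (Fin n) → List (Fin n)
  | _, [] => []
  | u, i :: L => detourStep J u i ++ detour J (flipBit u i) L

/-- The walk from `x` shadowing the walk with directions `L`. -/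
def shadow (J : ChoiceIndex n → Fin n) (x : Cube n) (L : List (Fin n)) : List (Fin n) :=
  J (.inl x) :: (detour J x L ++ [J (.inl (endpoint x L))])

lemma endpoint_detourStep (J : ChoiceIndex n → Fin n) (u : Cube n) (i : Fin n) :
    endpoint (flipBit u (J (.inl u))) (detourStep J u i)
      = flipBit (flipBit u i) (J (.inl (flipBit u i))) := by
  simp only [detourStep, endpoint_cons, endpoint_nil]
  generalize J (.inr _) = l
  generalize J (.inl u) = j
  generalize J (.inl _) = k
  -- On the left `l` and `j` are each flipped twice and cancel.
  funext c
  simp only [flipBit_apply]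
  split_ifs <;> simp_all

lemma endpoint_detour (J : ChoiceIndex n → Fin n) (u : Cube n) (L : List (Fin n)) :
    endpoint (flipBit u (J (.inl u))) (detour J u L)
      = flipBit (endpoint u L) (J (.inl (endpoint u L))) := by
  induction L generalizing u with
  | nil => rfl
  | cons i L ih => rw [detour, endpoint_append, endpoint_detourStep, ih, endpoint_cons]

lemma endpoint_shadow (J : ChoiceIndex n → Fin n) (x : Cube n) (L : List (Fin n)) :
    endpoint x (shadow J x L) = endpoint x L := by
  rw [shadow, endpoint_cons, endpoint_append, endpoint_detour, endpoint_cons, endpoint_nil,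
    flipBit_flipBit]

lemma length_shadow (J : ChoiceIndex n → Fin n) (x : Cube n) (L : List (Fin n)) :
    (shadow J x L).length = 5 * L.length + 2 := by
  have : ∀ u, (detour J u L).length = 5 * L.length := by
    induction L with
    | nil => simp [detour]
    | cons i L ih => intro u; simp [detour, detourStep, ih]; ring
  simp [shadow, this]

lemma exists_mem_detourTrace (J : ChoiceIndex n → Fin n) (u : Cube n) (L : List (Fin n))
    (q : Cube n × Fin n) (hq : q ∈ trace (flipBit u (J (.inl u))) (detour J u L)) :
    ∃ e ∈ trace u L, q ∈ detourTrace e.1 e.2 (J (.inl e.1)) (J (.inl (flipBit e.1 e.2)))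
      (J (.inr (e.1, e.2, J (.inl e.1), J (.inl (flipBit e.1 e.2))))) := by
  induction L generalizing u with
  | nil => simp [detour] at hq
  | cons i L ih =>
    rw [detour, trace_append, endpoint_detourStep, List.mem_append] at hq
    rcases hq with hq | hq
    · exact ⟨(u, i), by simp, hq⟩
    · obtain ⟨e, he, h⟩ := ih _ hq
      exact ⟨e, by simp [he], h⟩

lemma mem_trace_shadow (J : ChoiceIndex n → Fin n) (x : Cube n) (L : List (Fin n))
    (v : Cube n) (d : Fin n) (hq : (v, d) ∈ trace x (shadow J x L)) :
    (x = v ∧ J (.inl v) = d) ∨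
    (endpoint x L = flipBit v d ∧ J (.inl (flipBit v d)) = d) ∨
    ∃ e ∈ trace x L, (v, d) ∈ detourTrace e.1 e.2 (J (.inl e.1)) (J (.inl (flipBit e.1 e.2)))
      (J (.inr (e.1, e.2, J (.inl e.1), J (.inl (flipBit e.1 e.2))))) := by
  rw [shadow, trace_cons, trace_append, endpoint_detour, List.mem_cons, List.mem_append,
    Prod.mk.injEq] at hq
  rcases hq with ⟨rfl, rfl⟩ | hq | hq
  · exact Or.inl ⟨rfl, rfl⟩
  · exact Or.inr (Or.inr (exists_mem_detourTrace J x L _ hq))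
  · simp only [trace_cons, trace_nil, List.mem_singleton, Prod.mk.injEq] at hq
    obtain ⟨rfl, rfl⟩ := hq
    exact Or.inr (Or.inl ⟨by rw [flipBit_flipBit], by rw [flipBit_flipBit]⟩)

end Routes

/-! ### Flows from random paths. -/

section RandomPath

variable {V : Type*} [Fintype V] [DecidableEq V] {G : SimpleGraph V} [DecidableRel G.Adj]

/-- A family of random paths, uniform over a finite set of seeds, defines a flow. -/
theorem exists_flow_of_random_path {Θ : Type*} (T : Finset Θ) (hT : T.Nonempty)
    (p : ∀ x y, Θ → G.Path x y) (π : V → ℝ) (hπ : ∀ x, 0 ≤ π x) (ℓ : ℝ)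
    (hℓ : ∀ x y θ, ((p x y θ).1.length : ℝ) ≤ ℓ) :
    ∃ f : MulticommodityFlow G, ∀ e, edgeLoad G π f e ≤ ℓ *
      ∑ x, ∑ y, π x * π y * (((T.filter fun θ => e ∈ (p x y θ).1.darts).card : ℝ) / T.card) := by
  have hT0 : (0 : ℝ) < T.card := by exact_mod_cast hT.card_pos
  -- The flow on a path is the proportion of seeds producing it.
  let f : MulticommodityFlow G :=
    { val := fun {x y} q => ((T.filter fun θ => p x y θ = q).card : ℝ) / T.card
      nonneg := fun q => by positivity
      unit := fun x y _ => by
        rw [← Finset.sum_div, ← Nat.cast_sum,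
          ← Finset.card_eq_sum_card_fiberwise (f := p x y) (fun _ _ => Finset.mem_univ _)]
        exact div_self hT0.ne' }
  refine ⟨f, fun e => ?_⟩
  rw [edgeLoad, Finset.mul_sum]
  refine Finset.sum_le_sum fun x _ => ?_
  rw [Finset.mul_sum]
  refine Finset.sum_le_sum fun y _ => ?_
  have hcard : ((T.filter fun θ => e ∈ (p x y θ).1.darts).card : ℝ)
      = ∑ q : G.Path x y, if e ∈ q.1.darts then ((T.filter fun θ => p x y θ = q).card : ℝ)
        else 0 := by
    rw [Finset.card_eq_sum_card_fiberwise (f := p x y) (fun _ _ => Finset.mem_univ _),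
      Nat.cast_sum]
    refine Finset.sum_congr rfl fun q _ => ?_
    rw [Finset.filter_filter]
    split_ifs with h
    · congr 2
      refine Finset.filter_congr fun θ _ => ?_
      exact ⟨fun h' => h'.2, fun h' => ⟨h' ▸ h, h'⟩⟩
    · rw [Nat.cast_eq_zero, Finset.card_eq_zero]
      exact Finset.filter_eq_empty_iff.2 fun θ _ h' => h (h'.2 ▸ h'.1)
  rw [hcard, Finset.sum_div, Finset.mul_sum, Finset.mul_sum]
  refine Finset.sum_le_sum fun q _ => ?_
  split_ifs with h
  · have hval : f.val q = ((T.filter fun θ => p x y θ = q).card : ℝ) / T.card := rfl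
    rw [hval]
    rcases Finset.eq_empty_or_nonempty (T.filter fun θ => p x y θ = q) with he | ⟨θ, hθ⟩
    · simp [he]
    · have hl := hℓ x y θ
      rw [(Finset.mem_filter.1 hθ).2] at hl
      rw [mul_comm ℓ]
      exact mul_le_mul_of_nonneg_left hl
        (mul_nonneg (mul_nonneg (hπ _) (hπ _)) (by positivity))
  · simp

end RandomPath

/-! ### How often a random detour uses a given edge. -/

section Counting

variable {n : ℕ}

/-- A uniform element of a product has uniform coordinates, so each value has probability at most `1
/ |t a| ≤ 2 / n`. -/
lemma card_filter_piFinset_le {ι : Type*} [Fintype ι] [DecidableEq ι] (t : ι → Finset (Fin n))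
    (a : ι) (j : Fin n) (ha : n ≤ 2 * (t a).card) :
    n * ((Fintype.piFinset t).filter fun J => J a = j).card ≤ 2 * (Fintype.piFinset t).card := by
  have h : ((Fintype.piFinset t).filter fun J => J a = j).card
      = if j ∈ t a then ∏ b ∈ Finset.univ.erase a, (t b).card else 0 :=
    Fintype.card_filter_piFinset_eq t a j
  rw [h, Fintype.card_piFinset]
  split_ifs with hj
  · rw [← Finset.mul_prod_erase Finset.univ (fun i => (t i).card) (Finset.mem_univ a), ← mul_assoc]
    exact Nat.mul_le_mul_right _ ha
  · simp

/-- Distinct coordinates are independent. This is obtained by fixing them one at a time: replacing a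
factor by a singleton leaves a product. -/
lemma card_filter_piFinset_le_three {ι : Type*} [Fintype ι] [DecidableEq ι]
    (t : ι → Finset (Fin n)) (ht : ∀ a, n ≤ 2 * (t a).card) {a b c : ι} (hab : a ≠ b)
    (hac : a ≠ c) (hbc : b ≠ c) (j k l : Fin n) :
    n ^ 3 * ((Fintype.piFinset t).filter fun J => J a = j ∧ J b = k ∧ J c = l).card
      ≤ 8 * (Fintype.piFinset t).card := by
  by_cases hj : j ∈ t a
  swap
  · have he : ((Fintype.piFinset t).filter fun J => J a = j ∧ J b = k ∧ J c = l) = ∅ :=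
      Finset.filter_eq_empty_iff.2 fun J hJ h =>
        hj (h.1 ▸ Fintype.mem_piFinset.1 hJ a)
    simp [he]
  by_cases hk : k ∈ t b
  swap
  · have he : ((Fintype.piFinset t).filter fun J => J a = j ∧ J b = k ∧ J c = l) = ∅ :=
      Finset.filter_eq_empty_iff.2 fun J hJ h =>
        hk (h.2.1 ▸ Fintype.mem_piFinset.1 hJ b)
    simp [he]
  set t₁ := Function.update t a {j} with ht₁
  set t₂ := Function.update t₁ b {k} with ht₂
  have e₁ : Fintype.piFinset t₁ = (Fintype.piFinset t).filter fun J => J a = j :=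
    Fintype.piFinset_update_singleton_eq_filter_piFinset_eq t a hj
  have e₂ : Fintype.piFinset t₂ = (Fintype.piFinset t₁).filter fun J => J b = k :=
    Fintype.piFinset_update_singleton_eq_filter_piFinset_eq t₁ b (by simpa [ht₁, hab.symm] using hk)
  have h₁ := card_filter_piFinset_le t a j (ht a)
  have h₂ := card_filter_piFinset_le t₁ b k (by simpa [ht₁, hab.symm] using ht b)
  have h₃ := card_filter_piFinset_le t₂ c l (by simpa [ht₁, ht₂, hac.symm, hbc.symm] using ht c)
  have e₃ : ((Fintype.piFinset t).filter fun J => J a = j ∧ J b = k ∧ J c = l)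
      = (Fintype.piFinset t₂).filter fun J => J c = l := by
    rw [e₂, e₁, Finset.filter_filter, Finset.filter_filter]
  rw [← e₁] at h₁
  rw [← e₂] at h₂
  rw [e₃]
  calc n ^ 3 * ((Fintype.piFinset t₂).filter fun J => J c = l).card
      = n * (n * (n * ((Fintype.piFinset t₂).filter fun J => J c = l).card)) := by ring
    _ ≤ n * (n * (2 * (Fintype.piFinset t₂).card)) := by gcongr
    _ = 2 * (n * (n * (Fintype.piFinset t₂).card)) := by ring
    _ ≤ 2 * (n * (2 * (Fintype.piFinset t₁).card)) := by gcongr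
    _ = 4 * (n * (Fintype.piFinset t₁).card) := by ring
    _ ≤ 4 * (2 * (Fintype.piFinset t).card) := by gcongr
    _ = _ := by ring

/-- For each of the five positions, `d` determines one of `i, j, k, l`; the other three are free and
then `v` determines `u`. -/
lemma card_filter_detourTrace_le (q : Cube n × Fin n) :
    (Finset.univ.filter fun w : Cube n × Fin n × Fin n × Fin n × Fin n =>
      q ∈ detourTrace w.1 w.2.1 w.2.2.1 w.2.2.2.1 w.2.2.2.2).card ≤ 5 * n ^ 3 := by
  obtain ⟨v, d⟩ := q
  have hinj : ∀ (P : Cube n × Fin n × Fin n × Fin n × Fin n → Prop) [DecidablePred P]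
      (g : Cube n × Fin n × Fin n × Fin n × Fin n → Fin n × Fin n × Fin n),
      (∀ w w', P w → P w' → g w = g w' → w = w') → (Finset.univ.filter P).card ≤ n ^ 3 := by
    intro P _ g hg
    calc (Finset.univ.filter P).card
        ≤ (Finset.univ : Finset (Fin n × Fin n × Fin n)).card := by
          refine Finset.card_le_card_of_injOn g (fun _ _ => Finset.mem_univ _) ?_
          intro w hw w' hw' h
          exact hg w w' (by simpa using hw) (by simpa using hw') h
      _ = n ^ 3 := by simp [pow_succ, mul_assoc]
  have hf : ∀ (i : Fin n) {u u' : Cube n}, flipBit u i = flipBit u' i → u = u' :=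
    fun i _ _ h => flipBit_left_injective i h
  have h1 := hinj (fun w => v = flipBit w.1 w.2.2.1 ∧ d = w.2.2.2.2)
    (fun w => (w.2.1, w.2.2.1, w.2.2.2.1)) (by
      rintro ⟨u, i, j, k, l⟩ ⟨u', i', j', k', l'⟩ ⟨h, h'⟩ ⟨h'', h'''⟩ hg
      simp only [Prod.mk.injEq] at hg h h' h'' h''' ⊢
      obtain ⟨rfl, rfl, rfl⟩ := hg
      subst h' h'''
      exact ⟨hf _ (h.symm.trans h''), rfl, rfl, rfl, rfl⟩)
  have h2 := hinj (fun w => v = flipBit (flipBit w.1 w.2.2.1) w.2.2.2.2 ∧ d = w.2.2.2.1)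
    (fun w => (w.2.1, w.2.2.1, w.2.2.2.2)) (by
      rintro ⟨u, i, j, k, l⟩ ⟨u', i', j', k', l'⟩ ⟨h, h'⟩ ⟨h'', h'''⟩ hg
      simp only [Prod.mk.injEq] at hg h h' h'' h''' ⊢
      obtain ⟨rfl, rfl, rfl⟩ := hg
      subst h' h'''
      exact ⟨hf _ (hf _ (h.symm.trans h'')), rfl, rfl, rfl, rfl⟩)
  have h3 := hinj (fun w => v = flipBit (flipBit (flipBit w.1 w.2.2.1) w.2.2.2.2) w.2.2.2.1 ∧
      d = w.2.1)
    (fun w => (w.2.2.1, w.2.2.2.1, w.2.2.2.2)) (by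
      rintro ⟨u, i, j, k, l⟩ ⟨u', i', j', k', l'⟩ ⟨h, h'⟩ ⟨h'', h'''⟩ hg
      simp only [Prod.mk.injEq] at hg h h' h'' h''' ⊢
      obtain ⟨rfl, rfl, rfl⟩ := hg
      subst h' h'''
      exact ⟨hf _ (hf _ (hf _ (h.symm.trans h''))), rfl, rfl, rfl, rfl⟩)
  have h4 := hinj (fun w => v = flipBit (flipBit (flipBit (flipBit w.1 w.2.2.1) w.2.2.2.2)
      w.2.2.2.1) w.2.1 ∧ d = w.2.2.1)
    (fun w => (w.2.1, w.2.2.2.1, w.2.2.2.2)) (by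
      rintro ⟨u, i, j, k, l⟩ ⟨u', i', j', k', l'⟩ ⟨h, h'⟩ ⟨h'', h'''⟩ hg
      simp only [Prod.mk.injEq] at hg h h' h'' h''' ⊢
      obtain ⟨rfl, rfl, rfl⟩ := hg
      subst h' h'''
      exact ⟨hf _ (hf _ (hf _ (hf _ (h.symm.trans h'')))), rfl, rfl, rfl, rfl⟩)
  have h5 := hinj (fun w => v = flipBit (flipBit (flipBit (flipBit (flipBit w.1 w.2.2.1)
      w.2.2.2.2) w.2.2.2.1) w.2.1) w.2.2.1 ∧ d = w.2.2.2.2)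
    (fun w => (w.2.1, w.2.2.1, w.2.2.2.1)) (by
      rintro ⟨u, i, j, k, l⟩ ⟨u', i', j', k', l'⟩ ⟨h, h'⟩ ⟨h'', h'''⟩ hg
      simp only [Prod.mk.injEq] at hg h h' h'' h''' ⊢
      obtain ⟨rfl, rfl, rfl⟩ := hg
      subst h' h'''
      exact ⟨hf _ (hf _ (hf _ (hf _ (hf _ (h.symm.trans h''))))), rfl, rfl, rfl, rfl⟩)
  simp only [detourTrace, trace_cons, trace_nil, List.mem_cons, List.not_mem_nil, or_false,
    Prod.mk.injEq, Finset.filter_or]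
  refine (Finset.card_union_le _ _).trans ?_
  refine (add_le_add h1 ((Finset.card_union_le _ _).trans (add_le_add h2
    ((Finset.card_union_le _ _).trans (add_le_add h3 ((Finset.card_union_le _ _).trans
      (add_le_add h4 h5))))))).trans (le_of_eq ?_)
  ring

/-- Averaged over the random choices, every directed edge is used by at most `40` replacements. -/
lemma sum_card_detourTrace_le (hn : 0 < n) (t : ChoiceIndex n → Finset (Fin n))
    (ht : ∀ a, n ≤ 2 * (t a).card) (q : Cube n × Fin n) :
    ∑ e : Cube n × Fin n, ((Fintype.piFinset t).filter fun J =>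
      q ∈ detourTrace e.1 e.2 (J (.inl e.1)) (J (.inl (flipBit e.1 e.2)))
        (J (.inr (e.1, e.2, J (.inl e.1), J (.inl (flipBit e.1 e.2)))))).card
      ≤ 40 * (Fintype.piFinset t).card := by
  have h1 : ∀ e : Cube n × Fin n, n ^ 3 * ((Fintype.piFinset t).filter fun J =>
      q ∈ detourTrace e.1 e.2 (J (.inl e.1)) (J (.inl (flipBit e.1 e.2)))
        (J (.inr (e.1, e.2, J (.inl e.1), J (.inl (flipBit e.1 e.2)))))).card
      ≤ ∑ w : Fin n × Fin n × Fin n, if q ∈ detourTrace e.1 e.2 w.1 w.2.1 w.2.2 then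
        8 * (Fintype.piFinset t).card else 0 := by
    -- The choice of `l` is indexed by `(u, i, j, k)`; once `j` and `k` are fixed, the three
    -- coordinates of `J` involved are fixed and distinct, hence independent.
    rintro ⟨u, i⟩
    rw [Finset.card_eq_sum_card_fiberwise (t := Finset.univ)
      (f := fun J => (J (.inl u), J (.inl (flipBit u i)),
        J (.inr (u, i, J (.inl u), J (.inl (flipBit u i)))))) (fun _ _ => Finset.mem_univ _),
      Finset.mul_sum]
    refine Finset.sum_le_sum ?_
    rintro ⟨j, k, l⟩ _
    rw [Finset.filter_filter]
    split_ifs with h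
    · refine le_trans (Nat.mul_le_mul_left _ (Finset.card_le_card ?_))
        (card_filter_piFinset_le_three t ht (a := .inl u) (b := .inl (flipBit u i))
          (c := .inr (u, i, j, k)) (by simpa using (flipBit_ne u i).symm) (by simp) (by simp) j k l)
      refine Finset.monotone_filter_right _ fun J _ hJ => ?_
      have hJ' := hJ.2
      simp only [Prod.mk.injEq] at hJ'
      obtain ⟨rfl, rfl, rfl⟩ := hJ'
      exact ⟨rfl, rfl, rfl⟩
    · rw [Finset.filter_eq_empty_iff.2, Finset.card_empty, mul_zero]
      rintro J _ ⟨hJ, hJ'⟩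
      simp only [Prod.mk.injEq] at hJ'
      obtain ⟨rfl, rfl, rfl⟩ := hJ'
      exact h hJ
  have h2 : n ^ 3 * ∑ e : Cube n × Fin n, ((Fintype.piFinset t).filter fun J =>
      q ∈ detourTrace e.1 e.2 (J (.inl e.1)) (J (.inl (flipBit e.1 e.2)))
        (J (.inr (e.1, e.2, J (.inl e.1), J (.inl (flipBit e.1 e.2)))))).card
      ≤ n ^ 3 * (40 * (Fintype.piFinset t).card) := by
    rw [Finset.mul_sum]
    refine (Finset.sum_le_sum fun e _ => h1 e).trans ?_
    rw [← Fintype.sum_prod_type', ← Finset.sum_filter, Finset.sum_const, smul_eq_mul]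
    have h3 : (Finset.univ.filter fun x : (Cube n × Fin n) × Fin n × Fin n × Fin n =>
        q ∈ detourTrace x.1.1 x.1.2 x.2.1 x.2.2.1 x.2.2.2).card ≤ 5 * n ^ 3 := by
      refine le_trans (le_of_eq ?_) (card_filter_detourTrace_le q)
      exact Finset.card_equiv (Equiv.prodAssoc _ _ _) (by simp)
    calc _ ≤ 5 * n ^ 3 * (8 * (Fintype.piFinset t).card) := Nat.mul_le_mul_right _ h3
      _ = _ := by ring
  exact Nat.le_of_mul_le_mul_left h2 (by positivity)

end Counting

/-! ### Heavy choices, and the load of the bit-fixing walks. -/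

section Load

variable {n : ℕ} {z : Cube n → ℝ}

lemma threshold_pos : 0 < threshold := by unfold threshold; positivity

lemma threshold_le_one : threshold ≤ 1 := by unfold threshold; norm_num

/-- The choices for which the replacing walks avoid light vertices. -/
noncomputable def allowed (z : Cube n → ℝ) : ChoiceIndex n → Finset (Fin n)
  | .inl u => Finset.univ.filter fun j => threshold ≤ z (flipBit u j)
  | .inr (u, i, j, k) => Finset.univ.filter fun l =>
      threshold ≤ z (flipBit (flipBit u j) l) ∧
      threshold ≤ z (flipBit (flipBit (flipBit u j) k) l) ∧
      threshold ≤ z (flipBit (flipBit (flipBit (flipBit u j) k) i) l) ∧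
      threshold ≤ z (flipBit (flipBit (flipBit u k) i) l)

/-- At most four vertices impose a condition on the direction, each excluding at most `n / 8`
values. -/
lemma le_two_mul_card_allowed (h : WellSpread n z) (a : ChoiceIndex n) :
    n ≤ 2 * (allowed z a).card := by
  have hc : ∀ s : Finset (Fin n), s.card + sᶜ.card = n := fun s => by
    rw [Finset.card_add_card_compl, Fintype.card_fin]
  let B : Cube n → Finset (Fin n) := fun v => Finset.univ.filter fun l =>
    z (flipBit v l) < threshold
  have hB : ∀ v, 8 * (B v).card ≤ n := h.few_light
  rcases a with u | ⟨u, i, j, k⟩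
  · have h1 : (allowed z (.inl u))ᶜ ⊆ B u := fun l hl => by
      simpa [allowed, B] using hl
    have := Finset.card_le_card h1
    have := hc (allowed z (.inl u))
    have := hB u
    omega
  · have h1 : (allowed z (.inr (u, i, j, k)))ᶜ ⊆ (B (flipBit u j) ∪ B (flipBit (flipBit u j) k)) ∪
        (B (flipBit (flipBit (flipBit u j) k) i) ∪ B (flipBit (flipBit u k) i)) := fun l hl => by
      simp only [allowed, Finset.mem_compl, Finset.mem_filter, Finset.mem_univ, true_and] at hl
      simp only [B, Finset.mem_union, Finset.mem_filter, Finset.mem_univ, true_and]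
      by_contra hcon
      simp only [not_or, not_lt] at hcon
      exact hl ⟨hcon.1.1, hcon.1.2, hcon.2.1, hcon.2.2⟩
    have h2 := (Finset.card_le_card h1).trans ((Finset.card_union_le _ _).trans
      (add_le_add (Finset.card_union_le _ _) (Finset.card_union_le _ _)))
    have := hc (allowed z (.inr (u, i, j, k)))
    have := hB (flipBit u j)
    have := hB (flipBit (flipBit u j) k)
    have := hB (flipBit (flipBit (flipBit u j) k) i)
    have := hB (flipBit (flipBit u k) i)
    omega

lemma threshold_le_of_mem_detourTrace (J : ChoiceIndex n → Fin n)
    (hJ : J ∈ Fintype.piFinset (allowed z)) (u v : Cube n) (i d : Fin n)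
    (h : (v, d) ∈ detourTrace u i (J (.inl u)) (J (.inl (flipBit u i)))
      (J (.inr (u, i, J (.inl u), J (.inl (flipBit u i)))))) :
    threshold ≤ z v ∧ threshold ≤ z (flipBit v d) := by
  rw [Fintype.mem_piFinset] at hJ
  have h1 := hJ (.inl u)
  have h2 := hJ (.inl (flipBit u i))
  have h3 := hJ (.inr (u, i, J (.inl u), J (.inl (flipBit u i))))
  revert h h1 h2 h3
  generalize J (.inr _) = l
  generalize J (.inl u) = j
  generalize J (.inl _) = k
  intro h h1 h2 h3
  simp only [allowed, Finset.mem_filter, Finset.mem_univ, true_and] at h1 h2 h3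
  obtain ⟨h3, h4, h5, h6⟩ := h3
  -- Flips commute, so each intermediate vertex can be written with `l` flipped last, as in
  -- `allowed`.
  have e1 : flipBit (flipBit (flipBit u j) l) k = flipBit (flipBit (flipBit u j) k) l :=
    flipBit_right_comm _ _ _
  have e2 : flipBit (flipBit (flipBit (flipBit u j) k) l) i
      = flipBit (flipBit (flipBit (flipBit u j) k) i) l := flipBit_right_comm _ _ _
  have e3 : flipBit (flipBit (flipBit (flipBit (flipBit u j) k) i) l) j
      = flipBit (flipBit (flipBit u k) i) l := by
    rw [flipBit_right_comm _ l j, flipBit_right_comm _ i j, flipBit_right_comm _ k j,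
      flipBit_flipBit]
  have e4 : flipBit (flipBit (flipBit (flipBit u k) i) l) l = flipBit (flipBit u i) k := by
    rw [flipBit_flipBit, flipBit_right_comm]
  simp only [detourTrace, trace_cons, trace_nil, List.mem_cons, List.not_mem_nil, or_false,
    Prod.mk.injEq, e1, e2, e3] at h
  rcases h with ⟨rfl, rfl⟩ | ⟨rfl, rfl⟩ | ⟨rfl, rfl⟩ | ⟨rfl, rfl⟩ | ⟨rfl, rfl⟩
  · exact ⟨h1, h3⟩
  · exact ⟨h3, e1 ▸ h4⟩
  · exact ⟨h4, e2 ▸ h5⟩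
  · exact ⟨h5, e3 ▸ h6⟩
  · exact ⟨h6, e4 ▸ h2⟩

/-- Double counting: every vertex has at least `n / 2` heavy neighbours, and every vertex is a
neighbour `n` times. -/
lemma two_pow_le_of_wellSpread (h : WellSpread n z) (hn : 1 ≤ n) :
    threshold * 2 ^ n ≤ 2 * ∑ x, z x := by
  have hbound : ∀ v : Cube n, threshold * n ≤ 2 * ∑ l, z (flipBit v l) := by
    intro v
    have hc : n ≤ 2 * (allowed z (.inl v)).card := le_two_mul_card_allowed h _
    calc threshold * (n : ℝ) ≤ threshold * (2 * (allowed z (.inl v)).card) :=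
          mul_le_mul_of_nonneg_left (by exact_mod_cast hc) threshold_pos.le
      _ = 2 * ∑ _l ∈ allowed z (.inl v), threshold := by
          rw [Finset.sum_const, nsmul_eq_mul]; ring
      _ ≤ 2 * ∑ l ∈ allowed z (.inl v), z (flipBit v l) := by
          refine mul_le_mul_of_nonneg_left (Finset.sum_le_sum fun l hl => ?_) (by norm_num)
          simpa [allowed] using hl
      _ ≤ _ := mul_le_mul_of_nonneg_left (Finset.sum_le_sum_of_subset_of_nonneg
          (Finset.subset_univ _) fun l _ _ => (h.pos _).le) (by norm_num)
  have hsum : ∑ v, ∑ l, z (flipBit v l) = n * ∑ x, z x := by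
    rw [Finset.sum_comm]
    have : ∀ l, ∑ v, z (flipBit v l) = ∑ x, z x := fun l =>
      Equiv.sum_comp (Function.Involutive.toPerm (fun v : Cube n => flipBit v l)
        (fun v => flipBit_flipBit v l)) z
    simp [this]
  have h1 := Finset.sum_le_sum fun v (_ : v ∈ (Finset.univ : Finset (Cube n))) => hbound v
  rw [← Finset.mul_sum, ← Finset.mul_sum, hsum] at h1
  simp only [Finset.sum_const, Finset.card_univ, Fintype.card_pi, Fintype.card_bool,
    Finset.prod_const, Fintype.card_fin, nsmul_eq_mul, Nat.cast_pow, Nat.cast_ofNat] at h1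
  have hn' : (0 : ℝ) < n := by exact_mod_cast hn
  nlinarith

lemma sq_le_two_mul_two_pow (n : ℕ) : n ^ 2 ≤ 2 * 2 ^ n := by
  rcases Nat.lt_or_ge n 4 with h | h
  · interval_cases n <;> norm_num
  · induction n, h using Nat.le_induction with
    | base => norm_num
    | succ m hm ih => rw [pow_succ 2 m]; nlinarith

lemma sum_mul_two_pow_le (n : ℕ) :
    ∑ t ∈ Finset.range n, ((n : ℝ) + 2 ^ t) * (n + 2 ^ (n - t)) ≤ 6 * n * 2 ^ n := by
  have h1 : ∑ t ∈ Finset.range n, (2 : ℝ) ^ t ≤ 2 ^ n := by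
    rw [geom_sum_eq (by norm_num)]
    norm_num
  have h2 : ∑ t ∈ Finset.range n, (2 : ℝ) ^ (n - t) ≤ 2 * 2 ^ n := by
    have : ∀ t ∈ Finset.range n, (2 : ℝ) ^ (n - t) = 2 * 2 ^ (n - 1 - t) := fun t ht => by
      have := Finset.mem_range.1 ht
      rw [← pow_succ']
      congr 1
      omega
    rw [Finset.sum_congr rfl this, ← Finset.mul_sum,
      Finset.sum_range_reflect (fun t => (2 : ℝ) ^ t) n]
    linarith
  have h3 : ∀ t ∈ Finset.range n, ((n : ℝ) + 2 ^ t) * (n + 2 ^ (n - t))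
      = (n ^ 2 + 2 ^ n) + n * 2 ^ t + n * 2 ^ (n - t) := fun t ht => by
    have : (2 : ℝ) ^ n = 2 ^ t * 2 ^ (n - t) := by
      rw [← pow_add]
      congr 1
      have := Finset.mem_range.1 ht
      omega
    rw [this]
    ring
  rw [Finset.sum_congr rfl h3, Finset.sum_add_distrib, Finset.sum_add_distrib, ← Finset.mul_sum,
    ← Finset.mul_sum, Finset.sum_const, Finset.card_range, nsmul_eq_mul]
  have h4 : (n : ℝ) ^ 2 ≤ 2 * 2 ^ n := by exact_mod_cast sq_le_two_mul_two_pow n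
  have h5 : (0 : ℝ) ≤ n := Nat.cast_nonneg n
  nlinarith [mul_le_mul_of_nonneg_left h1 h5, mul_le_mul_of_nonneg_left h2 h5,
    mul_le_mul_of_nonneg_left h4 h5]

variable [NeZero n]

/-- The total weight of the pairs whose bit-fixing walk uses a given edge, averaged over the
cyclic orders, is of the order of the total weight. -/
lemma sum_trace_bitFixing_le (h : WellSpread n z) (u : Cube n) (i : Fin n) :
    ∑ s, ∑ x, ∑ y, (if (u, i) ∈ trace x (bitFixing x y (cyclicOrder s)) then z x * z y else 0)
      ≤ 384 * n * 2 ^ n := by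
  have h1 : ∀ s, ∑ x, ∑ y, (if (u, i) ∈ trace x (bitFixing x y (cyclicOrder s)) then z x * z y
      else 0) ≤ 64 * ((n + 2 ^ (i - s).val) * (n + 2 ^ (n - (i - s).val))) := by
    intro s
    calc _ ≤ ∑ x, ∑ y, (if x ∈ subcube u (precedingBits s i) then z x else 0) *
          (if y ∈ subcube u (precedingBits s i)ᶜ then z y else 0) := by
          refine Finset.sum_le_sum fun x _ => Finset.sum_le_sum fun y _ => ?_
          split_ifs with h1 h2 h3 h3 h2 h3 h3
          · exact le_rfl
          · exact absurd (mem_subcube_of_mem_trace x y u s i h1).2 h3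
          · exact absurd (mem_subcube_of_mem_trace x y u s i h1).1 h2
          · exact absurd (mem_subcube_of_mem_trace x y u s i h1).1 h2
          · exact mul_nonneg (h.pos _).le (h.pos _).le
          all_goals simp
      _ = (∑ x ∈ subcube u (precedingBits s i), z x) *
          ∑ y ∈ subcube u (precedingBits s i)ᶜ, z y := by
          rw [← Finset.sum_mul_sum, Finset.sum_ite_mem, Finset.sum_ite_mem, Finset.univ_inter,
            Finset.univ_inter]
      _ ≤ (8 * (n + 2 ^ (precedingBits s i).card)) *
          (8 * (n + 2 ^ (precedingBits s i)ᶜ.card)) :=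
          mul_le_mul (h.sum_subcube_le _ _) (h.sum_subcube_le _ _)
            (Finset.sum_nonneg fun _ _ => (h.pos _).le) (by positivity)
      _ = _ := by
          rw [Finset.card_compl, Fintype.card_fin, card_precedingBits]
          ring
  refine (Finset.sum_le_sum fun s _ => h1 s).trans ?_
  -- As `s` runs over all starting directions, the number `i - s` of bits already treated takes each
  -- value `0, …, n - 1` once.
  have h2 := (Equiv.subLeft i).sum_comp
    (fun t : Fin n => ((n : ℝ) + 2 ^ t.val) * (n + 2 ^ (n - t.val)))
  simp only [Equiv.subLeft_apply] at h2
  rw [← Finset.mul_sum, h2, Fin.sum_univ_eq_sum_range (fun t => ((n : ℝ) + 2 ^ t) * (n + 2 ^ (n - t))) n]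
  linarith [sum_mul_two_pow_le n]

end Load

/-! ### The load of the shadow walks on a directed edge. -/

section Resistance

variable {n : ℕ} {z : Cube n → ℝ}

lemma le_mul_of_wellSpread (h : WellSpread n z) (hn : 1 ≤ n) (v : Cube n) : z v ≤ 16 * n := by
  have h1 := h.sum_subcube_le v ∅
  have h2 : z v ≤ ∑ x ∈ subcube v ∅, z x :=
    Finset.single_le_sum (f := z) (fun x _ => (h.pos x).le) (by simp [subcube])
  have hn' : (1 : ℝ) ≤ n := by exact_mod_cast hn
  simp only [Finset.card_empty, pow_zero] at h1
  linarith

/-- The number of admissible choices that leave `v` in direction `d`. -/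
noncomputable def choiceCount (z : Cube n → ℝ) (v : Cube n) (d : Fin n) : ℕ :=
  ((Fintype.piFinset (allowed z)).filter fun J => J (.inl v) = d).card

/-- The number of admissible choices for which the replacement of the edge `e` uses the edge from
`v` in direction `d`. -/
noncomputable def detourCount (z : Cube n → ℝ) (v : Cube n) (d : Fin n) (e : Cube n × Fin n) : ℕ :=
  ((Fintype.piFinset (allowed z)).filter fun J =>
    (v, d) ∈ detourTrace e.1 e.2 (J (.inl e.1)) (J (.inl (flipBit e.1 e.2)))
      (J (.inr (e.1, e.2, J (.inl e.1), J (.inl (flipBit e.1 e.2)))))).card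

/-- The load on the first edge of the walks from `v`. -/
lemma choiceCount_mul_le (h : WellSpread n z) (hn : 1 ≤ n) (v : Cube n) (d : Fin n) :
    (choiceCount z v d : ℝ) * z v
      ≤ 32 / threshold * (Fintype.piFinset (allowed z)).card * min (z v) (z (flipBit v d)) := by
  rw [choiceCount]
  set M := (Fintype.piFinset (allowed z)).card
  set F := (Fintype.piFinset (allowed z)).filter fun J => J (.inl v) = d with hF
  have hthr := threshold_pos
  have hn' : (0 : ℝ) < n := by exact_mod_cast hn
  have hv := h.pos v
  have hw := h.pos (flipBit v d)
  have hK : 32 ≤ 32 / threshold := by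
    rw [le_div_iff₀ hthr]
    linarith [threshold_le_one]
  rcases F.eq_empty_or_nonempty with he | ⟨J, hJ⟩
  · rw [he, Finset.card_empty, Nat.cast_zero, zero_mul]
    exact mul_nonneg (mul_nonneg (by positivity) (Nat.cast_nonneg _)) (le_min hv.le hw.le)
  have hgood : threshold ≤ z (flipBit v d) := by
    obtain ⟨h1, rfl⟩ := Finset.mem_filter.1 hJ
    simpa [allowed] using Fintype.mem_piFinset.1 h1 (.inl v)
  -- If `v` is the lighter end, bounding the probability by one suffices. Otherwise the other end is
  -- heavy and the probability `2 / n` compensates `z v ≤ 16 n`.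
  rcases le_total (z v) (z (flipBit v d)) with hle | hle
  · rw [min_eq_left hle]
    refine mul_le_mul_of_nonneg_right ?_ hv.le
    have h1 : (F.card : ℝ) ≤ M := by exact_mod_cast Finset.card_filter_le _ _
    nlinarith [(Nat.cast_nonneg M : (0 : ℝ) ≤ M)]
  · rw [min_eq_right hle]
    have h1 : (n : ℝ) * F.card ≤ 2 * M := by
      exact_mod_cast card_filter_piFinset_le _ _ _ (le_two_mul_card_allowed h _)
    have h2 : (F.card : ℝ) * z v ≤ 32 * M := by
      have h3 := mul_le_mul_of_nonneg_left (le_mul_of_wellSpread h hn v)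
        (Nat.cast_nonneg F.card : (0 : ℝ) ≤ F.card)
      nlinarith
    refine h2.trans ?_
    rw [div_mul_eq_mul_div, div_mul_eq_mul_div, le_div_iff₀ hthr]
    exact mul_le_mul_of_nonneg_left hgood (by positivity)

variable [NeZero n]

/-- The seeds of the random walks: a starting direction and the local choices. -/
noncomputable def seeds (z : Cube n → ℝ) : Finset (Fin n × (ChoiceIndex n → Fin n)) :=
  Finset.univ ×ˢ Fintype.piFinset (allowed z)

/-- The random walk (as a list of directions) used to route from `x` to `y`. -/
def route (x y : Cube n) (θ : Fin n × (ChoiceIndex n → Fin n)) : List (Fin n) :=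
  shadow θ.2 x (bitFixing x y (cyclicOrder θ.1))

omit [NeZero n] in
lemma card_seeds (z : Cube n → ℝ) :
    (seeds z).card = n * (Fintype.piFinset (allowed z)).card := by
  simp [seeds]

lemma endpoint_bitFixing_cyclicOrder (x y : Cube n) (s : Fin n) :
    endpoint x (bitFixing x y (cyclicOrder s)) = y :=
  endpoint_bitFixing x y _ (nodup_cyclicOrder s) fun c hc => absurd (mem_cyclicOrder s c) hc

lemma endpoint_route (x y : Cube n) (θ : Fin n × (ChoiceIndex n → Fin n)) :
    endpoint x (route x y θ) = y := by
  rw [route, endpoint_shadow, endpoint_bitFixing_cyclicOrder]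

omit [NeZero n] in
lemma length_route_le (hn : 1 ≤ n) (x y : Cube n) (θ : Fin n × (ChoiceIndex n → Fin n)) :
    (route x y θ).length ≤ 7 * n := by
  have h1 : (bitFixing x y (cyclicOrder θ.1)).length ≤ (cyclicOrder θ.1).length :=
    List.length_filter_le _ _
  have h2 : (cyclicOrder θ.1).length = n := by simp [cyclicOrder]
  rw [route, length_shadow]
  omega

/-- A union bound: the edge is the first step, the last step, or part of the detour around some
bit-fixing edge. -/
lemma card_filter_route_le (x y v : Cube n) (d : Fin n) :
    ((seeds z).filter fun θ => (v, d) ∈ trace x (route x y θ)).card ≤ ∑ s : Fin n,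
      ((if x = v then choiceCount z v d else 0)
      + (if y = flipBit v d then choiceCount z (flipBit v d) d else 0)
      + ∑ e : Cube n × Fin n, if e ∈ trace x (bitFixing x y (cyclicOrder s)) then
        detourCount z v d e else 0) := by
  set Q := Fintype.piFinset (allowed z)
  rw [seeds, Finset.card_filter, Finset.sum_product]
  refine Finset.sum_le_sum fun s _ => ?_
  rw [← Finset.card_filter]
  refine le_trans (Finset.card_le_card (t :=
    ((if x = v then Q.filter (fun J => J (.inl v) = d) else ∅)
      ∪ (if y = flipBit v d then Q.filter (fun J => J (.inl (flipBit v d)) = d) else ∅))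
      ∪ Finset.univ.biUnion fun e : Cube n × Fin n =>
        if e ∈ trace x (bitFixing x y (cyclicOrder s)) then Q.filter (fun J =>
          (v, d) ∈ detourTrace e.1 e.2 (J (.inl e.1)) (J (.inl (flipBit e.1 e.2)))
          (J (.inr (e.1, e.2, J (.inl e.1), J (.inl (flipBit e.1 e.2)))))) else ∅) ?_) ?_
  · intro J hJ
    obtain ⟨hJ, hmem⟩ := Finset.mem_filter.1 hJ
    rcases mem_trace_shadow J x _ v d hmem with ⟨h1, h2⟩ | ⟨h1, h2⟩ | ⟨e, he, h2⟩
    · exact Finset.mem_union_left _ (Finset.mem_union_left _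
        (by rw [if_pos h1]; exact Finset.mem_filter.2 ⟨hJ, h2⟩))
    · rw [endpoint_bitFixing_cyclicOrder] at h1
      exact Finset.mem_union_left _ (Finset.mem_union_right _
        (by rw [if_pos h1]; exact Finset.mem_filter.2 ⟨hJ, h2⟩))
    · refine Finset.mem_union_right _ (Finset.mem_biUnion.2 ⟨e, Finset.mem_univ _, ?_⟩)
      rw [if_pos he]
      exact Finset.mem_filter.2 ⟨hJ, h2⟩
  · refine (Finset.card_union_le _ _).trans (add_le_add ((Finset.card_union_le _ _).trans
      (add_le_add ?_ ?_)) (Finset.card_biUnion_le.trans (Finset.sum_le_sum fun e _ => ?_)))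
    all_goals split_ifs
    all_goals exact le_rfl

lemma sum_detourCount_mul_le (h : WellSpread n z) (hn : 1 ≤ n) (v : Cube n) (d : Fin n) :
    ∑ e, (detourCount z v d e : ℝ) * ∑ s, ∑ x, ∑ y,
      (if e ∈ trace x (bitFixing x y (cyclicOrder s)) then z x * z y else 0)
      ≤ 30720 / threshold ^ 2 * n * (Fintype.piFinset (allowed z)).card * (∑ x, z x) *
        min (z v) (z (flipBit v d)) := by
  have hthr := threshold_pos
  have hm0 : 0 < min (z v) (z (flipBit v d)) := lt_min (h.pos _) (h.pos _)
  have hZ0 : 0 ≤ ∑ x, z x := Finset.sum_nonneg fun x _ => (h.pos x).le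
  by_cases h0 : ∀ e, detourCount z v d e = 0
  · simp only [h0, Nat.cast_zero, zero_mul, Finset.sum_const_zero]
    positivity
  -- An edge used by some detour has two heavy ends, which allows one factor `threshold` to be
  -- traded for the minimum.
  · have hgood : threshold ≤ min (z v) (z (flipBit v d)) := by
      obtain ⟨e, he⟩ := not_forall.1 h0
      obtain ⟨J, hJ⟩ := Finset.card_pos.1 (Nat.pos_of_ne_zero he)
      obtain ⟨hJ, hmem⟩ := Finset.mem_filter.1 hJ
      have := threshold_le_of_mem_detourTrace J hJ e.1 v e.2 d hmem
      exact le_min this.1 this.2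
    have h1 : ∑ e, (detourCount z v d e : ℝ) ≤ 40 * (Fintype.piFinset (allowed z)).card := by
      exact_mod_cast sum_card_detourTrace_le hn (allowed z) (le_two_mul_card_allowed h) (v, d)
    have h2 : (2 : ℝ) ^ n ≤ 2 * (∑ x, z x) / threshold := by
      rw [le_div_iff₀ hthr]
      linarith [two_pow_le_of_wellSpread h hn]
    calc _ ≤ ∑ e, (detourCount z v d e : ℝ) * (384 * n * 2 ^ n) := Finset.sum_le_sum fun e _ =>
          mul_le_mul_of_nonneg_left (sum_trace_bitFixing_le h e.1 e.2) (Nat.cast_nonneg _)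
      _ = (∑ e, (detourCount z v d e : ℝ)) * (384 * n * 2 ^ n) := by rw [Finset.sum_mul]
      _ ≤ 40 * (Fintype.piFinset (allowed z)).card * (384 * n * (2 * (∑ x, z x) / threshold)) := by gcongr
      _ = 30720 / threshold ^ 2 * n * (Fintype.piFinset (allowed z)).card * (∑ x, z x) * threshold := by field_simp; ring
      _ ≤ _ := by gcongr

/-- The load of every directed edge is at most of the order of the smaller weight of its ends. -/
theorem sum_card_filter_route_le (h : WellSpread n z) (hn : 1 ≤ n) (v : Cube n) (d : Fin n) :
    ∑ x, ∑ y, z x * z y * (((seeds z).filter fun θ => (v, d) ∈ trace x (route x y θ)).card : ℝ)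
      ≤ 40000 / threshold ^ 2 * (seeds z).card * (∑ x, z x) *
        min (z v) (z (flipBit v d)) := by
  set w := flipBit v d with hw
  set Z := ∑ x, z x with hZ
  set M : ℝ := ((Fintype.piFinset (allowed z)).card : ℝ) with hM
  set a : ℝ := (choiceCount z v d : ℝ) with ha
  set b : ℝ := (choiceCount z w d : ℝ) with hb
  set D : Cube n × Fin n → ℕ := detourCount z v d with hD
  set m := min (z v) (z w) with hm
  have hthr := threshold_pos
  have hn' : (0 : ℝ) < n := by exact_mod_cast hn
  have hm0 : 0 < m := lt_min (h.pos _) (h.pos _)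
  have hM0 : 0 ≤ M := Nat.cast_nonneg _
  have hZ0 : 0 ≤ Z := Finset.sum_nonneg fun x _ => (h.pos x).le
  have hA : a * z v ≤ 32 / threshold * M * m := choiceCount_mul_le h hn v d
  -- The last step into `w` is a first step out of `w`, reversed.
  have hB : b * z w ≤ 32 / threshold * M * m := by
    have := choiceCount_mul_le h hn w d
    rwa [hw, flipBit_flipBit, min_comm] at this
  have hC : ∑ e, (D e : ℝ) * ∑ s, ∑ x, ∑ y,
      (if e ∈ trace x (bitFixing x y (cyclicOrder s)) then z x * z y else 0)
      ≤ 30720 / threshold ^ 2 * n * M * Z * m := sum_detourCount_mul_le h hn v d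
  have hpt : ∀ x y, z x * z y *
      (((seeds z).filter fun θ => (v, d) ∈ trace x (route x y θ)).card : ℝ)
      ≤ ((if x = v then z v * z y * (n * a) else 0) + if y = w then z x * z w * (n * b) else 0) +
        ∑ e, (D e : ℝ) * ∑ s,
        (if e ∈ trace x (bitFixing x y (cyclicOrder s)) then z x * z y else 0) := by
    intro x y
    have h1 := (Nat.cast_le (α := ℝ)).2 (card_filter_route_le (z := z) x y v d)
    refine (mul_le_mul_of_nonneg_left h1 (mul_nonneg (h.pos x).le (h.pos y).le)).trans
      (le_of_eq ?_)
    have h2 : ∑ e, (D e : ℝ) * ∑ s,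
        (if e ∈ trace x (bitFixing x y (cyclicOrder s)) then z x * z y else 0)
        = z x * z y * ∑ s, ∑ e,
          (if e ∈ trace x (bitFixing x y (cyclicOrder s)) then (D e : ℝ) else 0) := by
      rw [Finset.sum_comm, Finset.mul_sum]
      refine Finset.sum_congr rfl fun e _ => ?_
      rw [Finset.mul_sum, Finset.mul_sum]
      refine Finset.sum_congr rfl fun s _ => ?_
      split_ifs <;> ring
    rw [h2]
    push_cast
    rw [Finset.sum_add_distrib, Finset.sum_const, Finset.card_univ, Fintype.card_fin, nsmul_eq_mul,
      mul_add]
    congr 1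
    split_ifs with hx hy hy
    · rw [hx, hy]; ring
    · rw [hx]; ring
    · rw [hy]; ring
    · ring
  refine (Finset.sum_le_sum fun x _ => Finset.sum_le_sum fun y _ => hpt x y).trans ?_
  simp_rw [Finset.sum_add_distrib]
  have e1 : ∑ x, ∑ y, (if x = v then z v * z y * (n * a) else 0) = n * Z * (a * z v) := by
    rw [Finset.sum_comm]
    simp only [Finset.sum_ite_eq', Finset.mem_univ, if_true]
    rw [← Finset.sum_mul, ← Finset.mul_sum]
    ring
  have e2 : ∑ x, ∑ y, (if y = w then z x * z w * (n * b) else 0) = n * Z * (b * z w) := by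
    simp only [Finset.sum_ite_eq', Finset.mem_univ, if_true]
    rw [← Finset.sum_mul, ← Finset.sum_mul]
    ring
  have e3 : ∑ x, ∑ y, ∑ e, (D e : ℝ) * ∑ s,
      (if e ∈ trace x (bitFixing x y (cyclicOrder s)) then z x * z y else 0)
      = ∑ e, (D e : ℝ) * ∑ s, ∑ x, ∑ y,
      (if e ∈ trace x (bitFixing x y (cyclicOrder s)) then z x * z y else 0) := by
    rw [Finset.sum_congr rfl fun x _ => Finset.sum_comm, Finset.sum_comm]
    refine Finset.sum_congr rfl fun e _ => ?_
    simp_rw [← Finset.mul_sum]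
    congr 1
    rw [Finset.sum_congr rfl fun x _ => Finset.sum_comm, Finset.sum_comm]
  rw [e1, e2, e3, card_seeds]
  push_cast
  have hx : 32 / threshold ≤ 32 / threshold ^ 2 :=
    div_le_div_of_nonneg_left (by norm_num) (by positivity)
      (by nlinarith [threshold_le_one])
  have hA' : n * Z * (a * z v) ≤ n * Z * (32 / threshold ^ 2 * M * m) := by
    refine mul_le_mul_of_nonneg_left (hA.trans ?_) (by positivity)
    gcongr
  have hB' : n * Z * (b * z w) ≤ n * Z * (32 / threshold ^ 2 * M * m) := by
    refine mul_le_mul_of_nonneg_left (hB.trans ?_) (by positivity)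
    gcongr
  have hpos : 0 ≤ n * M * Z * m / threshold ^ 2 := by positivity
  calc _ ≤ n * Z * (32 / threshold ^ 2 * M * m) + n * Z * (32 / threshold ^ 2 * M * m)
        + 30720 / threshold ^ 2 * n * M * Z * m := add_le_add (add_le_add hA' hB') hC
    _ = 30784 * (n * M * Z * m / threshold ^ 2) := by ring
    _ ≤ 40000 * (n * M * Z * m / threshold ^ 2) := by nlinarith
    _ = _ := by ring

end Resistance

/-! ### The transition matrix and the resistance of the flow. -/

section Chain

variable {n : ℕ} {π : Cube n → ℝ}

lemma card_neighborFinset_cubeGraph (x : Cube n) : ((cubeGraph n).neighborFinset x).card = n := by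
  have : (cubeGraph n).neighborFinset x = Finset.univ.image (flipBit x) := by
    ext y
    simp [adj_iff_exists_flipBit, eq_comm]
  rw [this, Finset.card_image_of_injective _ (flipBit_injective x), Finset.card_univ,
    Fintype.card_fin]

lemma transitionMatrix_apply_of_adj {x y : Cube n} (h : (cubeGraph n).Adj x y) :
    transitionMatrix n π x y = (1 / (n : ℝ)) * (π y / (π x + π y)) := by
  simp [transitionMatrix, h.ne, h]

lemma transitionMatrix_apply_nonneg (hπ : ∀ x, 0 < π x) (x y : Cube n) :
    0 ≤ transitionMatrix n π x y := by
  have hq : ∀ x y, 0 ≤ π y / (π x + π y) := fun x y =>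
    div_nonneg (hπ y).le (add_pos (hπ x) (hπ y)).le
  have hq' : ∀ x y, 0 ≤ π x / (π x + π y) := fun x y =>
    div_nonneg (hπ x).le (add_pos (hπ x) (hπ y)).le
  simp only [transitionMatrix, Matrix.of_apply]
  split_ifs
  · exact mul_nonneg (by positivity) (Finset.sum_nonneg fun _ _ => hq' _ _)
  · exact mul_nonneg (by positivity) (hq _ _)
  · exact le_rfl

lemma mul_transitionMatrix_comm (x y : Cube n) :
    π x * transitionMatrix n π x y = π y * transitionMatrix n π y x := by
  rcases eq_or_ne x y with rfl | hxy
  · rfl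
  by_cases h : (cubeGraph n).Adj x y
  · rw [transitionMatrix_apply_of_adj h, transitionMatrix_apply_of_adj h.symm, add_comm (π y)]
    ring
  · have h' : ¬ (cubeGraph n).Adj y x := fun h' => h h'.symm
    simp [transitionMatrix, hxy, hxy.symm, h, h']

lemma sum_transitionMatrix (hn : 1 ≤ n) (hπ : ∀ x, 0 < π x) (x : Cube n) :
    ∑ y, transitionMatrix n π x y = 1 := by
  have h1 : ∀ y, transitionMatrix n π x y
      = (if x = y then
          (1 / (n : ℝ)) * ∑ x' ∈ (cubeGraph n).neighborFinset x, π x / (π x + π x') else 0)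
        + if (cubeGraph n).Adj x y then (1 / (n : ℝ)) * (π y / (π x + π y)) else 0 := by
    intro y
    rcases eq_or_ne x y with rfl | hxy
    · simp [transitionMatrix]
    · simp [transitionMatrix, hxy]
  rw [Finset.sum_congr rfl fun y _ => h1 y, Finset.sum_add_distrib, Finset.sum_ite_eq,
    if_pos (Finset.mem_univ x), ← Finset.sum_filter, ← SimpleGraph.neighborFinset_eq_filter,
    ← Finset.mul_sum, ← mul_add, ← Finset.sum_add_distrib]
  have h2 : ∀ y ∈ (cubeGraph n).neighborFinset x, π x / (π x + π y) + π y / (π x + π y) = 1 :=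
    fun y _ => by rw [← add_div, div_self (add_pos (hπ x) (hπ y)).ne']
  have hn' : (n : ℝ) ≠ 0 := by positivity
  rw [Finset.sum_congr rfl h2, Finset.sum_const, card_neighborFinset_cubeGraph, nsmul_eq_mul,
    mul_one, one_div, inv_mul_cancel₀ hn']

lemma edgeMeasure_pos (hn : 1 ≤ n) (hπ : ∀ x, 0 < π x) (e : (cubeGraph n).Dart) :
    0 < π e.fst * transitionMatrix n π e.fst e.snd := by
  rw [transitionMatrix_apply_of_adj e.adj]
  have := hπ e.fst
  have := hπ e.snd
  positivity

/-- Well spread weights admit a flow of resistance of order `n ^ 2`. -/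
theorem exists_flow_resistance_le {z : Cube n → ℝ} (hn : 1 ≤ n) (h : WellSpread n z) :
    ∃ f : MulticommodityFlow (cubeGraph n),
      resistance (cubeGraph n) (normalized z) (transitionMatrix n (normalized z)) f
        ≤ 560000 / threshold ^ 2 * (n : ℝ) ^ 2 := by
  have : NeZero n := ⟨by omega⟩
  have hthr := threshold_pos
  have hn' : (0 : ℝ) < n := by exact_mod_cast hn
  set Z := ∑ x, z x with hZ
  have hZ0 : 0 < Z := Finset.sum_pos (fun x _ => h.pos x) Finset.univ_nonempty
  have hπ : ∀ x, normalized z x = z x / Z := fun x => rfl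
  have hπ0 : ∀ x, 0 < normalized z x := fun x => div_pos (h.pos x) hZ0
  have hseeds : (seeds z).Nonempty := by
    refine Finset.Nonempty.product ⟨0, Finset.mem_univ _⟩ (Fintype.piFinset_nonempty.2 fun a => ?_)
    have := le_two_mul_card_allowed h a
    exact Finset.card_pos.1 (by omega)
  choose p hlen hdart using fun x y (θ : Fin n × (ChoiceIndex n → Fin n)) =>
    exists_path_of_list x y (route x y θ) (endpoint_route x y θ)
  obtain ⟨f, hf⟩ := exists_flow_of_random_path (seeds z) hseeds p (normalized z)
    (fun x => (hπ0 x).le) (7 * n) (fun x y θ => by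
      exact_mod_cast (hlen x y θ).trans (length_route_le hn x y θ))
  refine ⟨f, Real.iSup_le (fun e => ?_) (by positivity)⟩
  change 1 / (normalized z e.fst * transitionMatrix n (normalized z) e.fst e.snd) *
    edgeLoad (cubeGraph n) (normalized z) f e ≤ _
  obtain ⟨d, hd⟩ := (adj_iff_exists_flipBit _ _).1 e.adj
  rw [one_div, inv_mul_le_iff₀ (edgeMeasure_pos hn hπ0 e), transitionMatrix_apply_of_adj e.adj]
  set v := e.fst with hv
  set w := e.snd with hw
  have hS : (0 : ℝ) < (seeds z).card := by exact_mod_cast hseeds.card_pos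
  have hload : ∑ x, ∑ y, normalized z x * normalized z y *
      ((((seeds z).filter fun θ => e ∈ (p x y θ).1.darts).card : ℝ) / (seeds z).card)
      ≤ 40000 / threshold ^ 2 * min (z v) (z w) / Z := by
    have h1 := sum_card_filter_route_le h hn v d
    rw [← hd] at h1
    calc _ ≤ ∑ x, ∑ y, (z x * z y * (((seeds z).filter fun θ =>
          (v, d) ∈ trace x (route x y θ)).card : ℝ)) / (Z ^ 2 * (seeds z).card) := by
          refine Finset.sum_le_sum fun x _ => Finset.sum_le_sum fun y _ => ?_
          have h2 : ((seeds z).filter fun θ => e ∈ (p x y θ).1.darts).card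
              ≤ ((seeds z).filter fun θ => (v, d) ∈ trace x (route x y θ)).card := by
            refine Finset.card_le_card (Finset.monotone_filter_right _ fun θ _ hθ => ?_)
            obtain ⟨i, hi, hi'⟩ := hdart x y θ e hθ
            rwa [flipBit_injective v (hd.symm.trans hi')]
          have h3 : normalized z x * normalized z y *
              ((((seeds z).filter fun θ => e ∈ (p x y θ).1.darts).card : ℝ) / (seeds z).card)
              = z x * z y * (((seeds z).filter fun θ => e ∈ (p x y θ).1.darts).card : ℝ)
                / (Z ^ 2 * (seeds z).card) := by
            rw [hπ, hπ]
            field_simp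
          rw [h3]
          refine div_le_div_of_nonneg_right ?_ (by positivity)
          exact mul_le_mul_of_nonneg_left (by exact_mod_cast h2)
            (mul_nonneg (h.pos x).le (h.pos y).le)
      _ ≤ (40000 / threshold ^ 2 * (seeds z).card * Z * min (z v) (z w))
            / (Z ^ 2 * (seeds z).card) := by
          simp_rw [← Finset.sum_div]
          exact div_le_div_of_nonneg_right h1 (by positivity)
      _ = _ := by field_simp
  refine (hf e).trans ((mul_le_mul_of_nonneg_left hload (by positivity)).trans ?_)
  have hzv := h.pos v
  have hzw := h.pos w
  -- The capacity `z v z w / (n Z (z v + z w))` is thus at least `min / (2 n Z)`; the constant is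
  -- `560000 = 7 * 40000 * 2`.
  have hmin : min (z v) (z w) * (z v + z w) ≤ 2 * (z v * z w) := by
    nlinarith [mul_le_mul_of_nonneg_right (min_le_left (z v) (z w)) hzw.le,
      mul_le_mul_of_nonneg_right (min_le_right (z v) (z w)) hzv.le]
  have hq : normalized z v * (1 / n * (normalized z w / (normalized z v + normalized z w)))
      = (z v * z w) / (n * Z * (z v + z w)) := by
    rw [hπ, hπ]
    field_simp
  rw [hq, ← sub_nonneg]
  have : z v * z w / (n * Z * (z v + z w)) * (560000 / threshold ^ 2 * (n : ℝ) ^ 2)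
      - 7 * n * (40000 / threshold ^ 2 * min (z v) (z w) / Z)
      = 280000 * n / (threshold ^ 2 * Z * (z v + z w)) *
        (2 * (z v * z w) - min (z v) (z w) * (z v + z w)) := by
    field_simp
    ring
  rw [this]
  exact mul_nonneg (by positivity) (sub_nonneg.2 hmin)

end Chain

end HypercubeWalk

/-! ### The main theorem. -/

open HypercubeWalk in
theorem mainTheorem3 :
    ∃ c : ℝ, 0 < c ∧ ∃ c' : ℝ, 0 < c' ∧
      ∀ (n : ℕ), 1 ≤ n →
      ∀ (Ω : Type*) [MeasurableSpace Ω] (μ : Measure Ω) [IsProbabilityMeasure μ]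
        (z : HypercubeWalk.Cube n → Ω → ℝ),
        (∀ x, HasLaw (z x) (expMeasure 1) μ) →
        iIndepFun z μ →
        ∃ A : Set Ω, MeasurableSet A ∧
          1 - (2 : ℝ) ^ (-(c * (n : ℝ))) ≤ μ.real A ∧
          ∀ ω ∈ A, ∀ (π : HypercubeWalk.Cube n → ℝ),
            π = HypercubeWalk.normalized (fun x => z x ω) →
            (∃ f : HypercubeWalk.MulticommodityFlow (HypercubeWalk.cubeGraph n),
              HypercubeWalk.resistance (HypercubeWalk.cubeGraph n) π
                (HypercubeWalk.transitionMatrix n π) f ≤ c' * (n : ℝ) ^ 2) ∧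
            HypercubeWalk.secondEigenvalue (HypercubeWalk.transitionMatrix n π) < 1 ∧
            HypercubeWalk.relaxationTime (HypercubeWalk.transitionMatrix n π)
              ≤ c' * (n : ℝ) ^ 2 := by
  have hthr := threshold_pos
  refine ⟨1, one_pos, 560000 / threshold ^ 2, by positivity, ?_⟩
  intro n hn Ω _ μ _ z hz hind
  have hn' : (0 : ℝ) < n := by exact_mod_cast hn
  set bad : Set Ω := {ω | ¬ WellSpread n fun x => z x ω} with hbad
  have hmeas := measurableSet_toMeasurable μ bad
  -- The weights are only almost everywhere measurable, so the bad set is enlarged to a measurable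
  -- set of the same measure.
  refine ⟨(toMeasurable μ bad)ᶜ, hmeas.compl, ?_, ?_⟩
  · rw [probReal_compl_eq_one_sub hmeas]
    refine sub_le_sub_left ?_ 1
    rw [one_mul, Real.rpow_neg (by norm_num), Real.rpow_natCast, ← inv_pow, ← one_div,
      measureReal_def, measure_toMeasurable]
    exact ENNReal.toReal_le_of_le_ofReal (by positivity) (measure_not_wellSpread_le hn hz hind)
  · rintro ω hω π rfl
    have hw : WellSpread n fun x => z x ω := by
      by_contra hcon
      exact hω (subset_toMeasurable μ bad hcon)
    have hZ0 : 0 < ∑ x, z x ω := Finset.sum_pos (fun x _ => hw.pos x) Finset.univ_nonempty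
    have hπ0 : ∀ x, 0 < normalized (fun x => z x ω) x := fun x => div_pos (hw.pos x) hZ0
    obtain ⟨f, hf⟩ := exists_flow_resistance_le hn hw
    set R := 560000 / threshold ^ 2 * (n : ℝ) ^ 2 with hR
    have hR0 : 0 < R := by positivity
    have hsec := secondEigenvalue_le_of_poincare
      (transitionMatrix n (normalized fun x => z x ω)) (normalized fun x => z x ω) R hR0
      (by simpa using (one_lt_pow₀ one_lt_two (by omega) : 1 < 2 ^ n)) hπ0
      (by simp only [normalized]; rw [← Finset.sum_div, div_self hZ0.ne'])
      mul_transitionMatrix_comm (sum_transitionMatrix hn hπ0)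
      (poincare_of_flow _ _ f R (fun x => (hπ0 x).le) (transitionMatrix_apply_nonneg hπ0)
        (edgeMeasure_pos hn hπ0) hR0.le hf)
    have hinv : 0 < 1 / R := by positivity
    refine ⟨⟨f, hf⟩, by linarith, ?_⟩
    rw [relaxationTime, div_le_iff₀ (by linarith)]
    have h1 : R * (1 / R) = 1 := mul_one_div_cancel hR0.ne'
    nlinarith
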